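/- Let $\mathscr D=\{[2^{-k}j,2^{-k}(j+1)):k,j\in\mathbb Z\}$. For $I\in\mathscr D$ let $I_-,I_+$ be its left and right dyadic children, $\widehat I$ its dyadic parent, $I^b$ its dyadic sibling (the other child of $\widehat I$), $I^b_\pm=(I^b)_\pm$, and let $I^{(n)}$ be its $n$-th dyadic ancestor ($I^{(0)}=I$). For $I,J\in\mathscr D$ put $\operatorname{dist}_{\mathscr D}(I,J)=\min\{s+t: s,t\ge 0,\ I^{(s)}=J^{(t)}\}$, and $\operatorname{dist}_{\mathscr D}(I,J)=\infty$ if $I$ and $J$ have no common dyadic ancestor. Let $\mu$ be a Radon measure on $\mathbb R$, and put $m(I)=\mu(I_-)\mu(I_+)/\mu(I)$ and $\langle g\rangle_I=\mu(I)^{-1}\int_I g\,d\mu$ (all quotients are $0$ when $\mu(I)=0$). Assume that $\mu$ is balanced, that is, $\mu$ has no atoms and there is a constant $C$ with $C^{-1}m(\widehat I)\le m(I)\le C\,m(\widehat I)$ for all $I\in\mathscr D$. For $p\in[1,\infty)$ put $c_p^b(I,J)=1$ if $I=J$, and $$c_p^b(I,J)=\frac{m(I)^{p/2}m(J)^{p/2}}{\mu(J)\,\mu(I)^{p-1}}\quad\text{otherwise}$$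 (again $0$ when $\mu(I)=\mu(J)=0$). For an integer $N\ge 1$ let $$\mathcal M^Nf(x)=\sup_{I,J\in\mathscr D:\ \operatorname{dist}_{\mathscr D}(I,J)\le N+2} c_1^b(I,J)\,\langle |f|\rangle_I\,1_J(x)\in[0,\infty].$$ Let $w$ be a weight, that is, $w\in L^1_{\mathrm{loc}}(\mu)$ and $w>0$ $\mu$-a.e. For $1<p<\infty$ and $p'=p/(p-1)$, we say that $w\in A_p^b(\mu)$ if $$\sup_{I,J}\ c_p^b(I,J)\,\langle w\rangle_I\,\langle w^{1-p'}\rangle_J^{p-1}<\infty,$$ and that $w\in A_1^b(\mu)$ if $$\sup_{I,J}\ c_1^b(I,J)\,\langle w\rangle_I\,\|w^{-1}\|_{L^\infty(J,\mu)}<\infty,$$ where both suprema are over all $I,J\in\mathscr D$ such that $J\in\{I,I^b_-,I^b_+\}$ or $I\in\{J^b_-,J^b_+\}$. **Proposition.** Let $\mu$ be balanced, let $w$ be a weight, and let $N\ge1$ be an integer. 1. For every $p\in(1,\infty)$: $\mathcal M^N$ is bounded on $L^p(w\,d\mu)$, i.e. there is $C<\infty$ with $\|\mathcal M^Nf\|_{L^p(w\,d\mu)}\le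 C\|f\|_{L^p(w\,d\mu)}$ for all $f\in L^p(w\,d\mu)$, if and only if $w\in A_p^b(\mu)$. 2. $\mathcal M^N$ is bounded from $L^1(w\,d\mu)$ to $L^{1,\infty}(w\,d\mu)$, i.e. there is $C<\infty$ with $\lambda\int_{\{\mathcal M^Nf>\lambda\}}w\,d\mu\le C\|f\|_{L^1(w\,d\mu)}$ for all $f\in L^1(w\,d\mu)$ and $\lambda>0$, if and only if $w\in A_1^b(\mu)$. -/

import Mathlib

open MeasureTheory Set
open scoped ENNReal NNReal

noncomputable section

namespace BalancedDyadic

/-- The standard dyadic intervals of the line: the pair `(k, j)` stands for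
`[2^(-k) * j, 2^(-k) * (j + 1))`, with `k` and `j` arbitrary integers. -/
@[ext]
structure DyadicInterval where
  k : ℤ
  j : ℤ

namespace DyadicInterval

/-- The interval as a subset of the line. -/
def toSet (I : DyadicInterval) : Set ℝ :=
  Ico ((2 : ℝ) ^ (-I.k) * I.j) ((2 : ℝ) ^ (-I.k) * (I.j + 1))

/-- The left dyadic child `I₋`. -/
def left (I : DyadicInterval) : DyadicInterval := ⟨I.k + 1, 2 * I.j⟩

/-- The right dyadic child `I₊`. -/
def right (I : DyadicInterval) : DyadicInterval := ⟨I.k + 1, 2 * I.j + 1⟩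

/-- The dyadic parent; integer division by `2` rounds down. -/
def parent (I : DyadicInterval) : DyadicInterval := ⟨I.k - 1, I.j / 2⟩

/-- The dyadic sibling `Iᵇ`: the other child of the parent. -/
def sibling (I : DyadicInterval) : DyadicInterval :=
  ⟨I.k, if I.j % 2 = 0 then I.j + 1 else I.j - 1⟩

/-- The ancestor `I⁽ⁿ⁾`, `n` generations above `I`. -/
def ancestor (n : ℕ) (I : DyadicInterval) : DyadicInterval := parent^[n] I

/-- The dyadic distance: the least `s + t` with `I⁽ˢ⁾ = J⁽ᵗ⁾`, and `∞` if there is no common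
ancestor. -/
def dist (I J : DyadicInterval) : ℕ∞ :=
  ⨅ (s : ℕ) (t : ℕ) (_ : ancestor s I = ancestor t J), ((s + t : ℕ) : ℕ∞)

end DyadicInterval

open DyadicInterval

variable (μ : Measure ℝ)

/-- The average over `I` with respect to `μ` of a function with values in `[0, ∞]`. It is `0` when
`μ I = 0`. -/
def average (g : ℝ → ℝ≥0∞) (I : DyadicInterval) : ℝ≥0∞ :=
  (∫⁻ x in I.toSet, g x ∂μ) / μ I.toSet

/-- `m(I) = μ(I₋) μ(I₊) / μ(I)`. It is `0` when `μ I = 0`. -/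
def m (I : DyadicInterval) : ℝ≥0∞ :=
  μ I.left.toSet * μ I.right.toSet / μ I.toSet

/-- A measure is balanced if it has no atoms and `m` of an interval is comparable to `m` of its
parent, with a uniform constant. -/
structure IsBalanced : Prop where
  noAtoms : ∀ x : ℝ, μ {x} = 0
  comparable : ∃ C : ℝ≥0, ∀ I : DyadicInterval,
    m μ I ≤ C * m μ I.parent ∧ m μ I.parent ≤ C * m μ I

open Classical in
/-- The factor `c_p^b(I, J)`. -/
def cb (p : ℝ) (I J : DyadicInterval) : ℝ≥0∞ :=
  if I = J then 1
  else m μ I ^ (p / 2) * m μ J ^ (p / 2) / (μ J.toSet * μ I.toSet ^ (p - 1))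

/-- The modified dyadic maximal operator `𝓜^N`. -/
def maximal (N : ℕ) (f : ℝ → ℝ) (x : ℝ) : ℝ≥0∞ :=
  ⨆ (I : DyadicInterval) (J : DyadicInterval) (_ : I.dist J ≤ (N + 2 : ℕ)),
    J.toSet.indicator (fun _ => cb μ 1 I J * average μ (fun y => ‖f y‖ₑ) I) x

/-- A weight: a locally integrable function that is positive almost everywhere. -/
structure IsWeight (w : ℝ → ℝ) : Prop where
  locallyIntegrable : LocallyIntegrable w μ
  pos : ∀ᵐ x ∂μ, 0 < w x

/-- The measure `w dμ`. -/
def weighted (w : ℝ → ℝ) : Measure ℝ := μ.withDensity fun x => ENNReal.ofReal (w x)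

/-- The pairs over which the suprema in the balanced characteristics are taken:
`J ∈ {I, (Iᵇ)₋, (Iᵇ)₊}` or `I ∈ {(Jᵇ)₋, (Jᵇ)₊}`. -/
def Adjacent (I J : DyadicInterval) : Prop :=
  (J = I ∨ J = I.sibling.left ∨ J = I.sibling.right) ∨
    (I = J.sibling.left ∨ I = J.sibling.right)

/-- The characteristic `[w]_{A_p^b(μ)}` for `1 < p < ∞`; `p.conjExponent` is `p' = p / (p - 1)`. -/
def apbChar (p : ℝ) (w : ℝ → ℝ) : ℝ≥0∞ :=
  ⨆ (I : DyadicInterval) (J : DyadicInterval) (_ : Adjacent I J),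
    cb μ p I J * average μ (fun x => ENNReal.ofReal (w x)) I *
      average μ (fun x => ENNReal.ofReal (w x ^ (1 - p.conjExponent))) J ^ (p - 1)

/-- The characteristic `[w]_{A_1^b(μ)}`. -/
def a1bChar (w : ℝ → ℝ) : ℝ≥0∞ :=
  ⨆ (I : DyadicInterval) (J : DyadicInterval) (_ : Adjacent I J),
    cb μ 1 I J * average μ (fun x => ENNReal.ofReal (w x)) I *
      eLpNorm (fun x => (w x)⁻¹) ∞ (μ.restrict J.toSet)

/-- The class `A_p^b(μ)` for `1 < p < ∞`. -/
def MemApb (p : ℝ) (w : ℝ → ℝ) : Prop := IsWeight μ w ∧ apbChar μ p w < ∞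

/-- The class `A_1^b(μ)`. -/
def MemA1b (w : ℝ → ℝ) : Prop := IsWeight μ w ∧ a1bChar μ w < ∞

/-- `T` is bounded on `L^p(ν)`. -/
def BoundedOnLp (ν : Measure ℝ) (p : ℝ≥0∞) (T : (ℝ → ℝ) → ℝ → ℝ≥0∞) : Prop :=
  ∃ C : ℝ≥0, ∀ f : ℝ → ℝ, MemLp f p ν → eLpNorm (T f) p ν ≤ C * eLpNorm f p ν

/-- `T` is bounded from `L^1(ν)` to `L^{1,∞}(ν)`. -/
def WeakTypeOneOne (ν : Measure ℝ) (T : (ℝ → ℝ) → ℝ → ℝ≥0∞) : Prop :=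
  ∃ C : ℝ≥0, ∀ f : ℝ → ℝ, MemLp f 1 ν →
    ∀ t : ℝ≥0, t * ν {x | (t : ℝ≥0∞) < T f x} ≤ C * eLpNorm f 1 ν

end BalancedDyadic

end

/-!
The operator `𝓜^N` takes an average over `I` and places it, with the coefficient `c_1^b(I, J)`, on
an interval `J` at bounded dyadic distance. Write `ν = w dμ` and call a dyadic interval light if
its sibling has at least its measure; for a light interval `μ(S)` is comparable to `m(S)`, because
`μ` is balanced.

*Sufficiency.* The condition on adjacent pairs is turned into two statements without the dual weight
(`Adapted`): the usual ratio inequality for nested intervals, and a comparison of `ν`-measures of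
adjacent intervals. Let `I` and `J` have the minimal common ancestor `K`. If `K` is not much
larger than `I` or than `J`, then `c_1^b(I, J) ⟨|f|⟩_I` is at most a constant times `⟨|f|⟩_K`.
Otherwise both `I` and `J` lie in light intervals below `K`, which are joined by a chain of
boundedly many light intervals, consecutive ones being adjacent; hence `ν(I)` and `ν(J)` are
comparable (`Adapted.exists_dichotomy`). So `𝓜^N f` is dominated by a maximal function over pairs
`(I, J)` in which `ν(J) ≤ c ν(I)` (`exists_maximal_le`). With averages taken with respect to `ν`,
such a maximal function is of weak type `(1, 1)`: if `I` is contained in a maximal interval `L`,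
then `J` is contained in `L` or is one of boundedly many intervals near `L` with `ν(J) ≤ c ν(L)`.
It is then bounded on `L^q(ν)` for `q > 1` by interpolation. For `p = 1` the averages over `I`
with respect to `μ` are controlled by those with respect to `ν`. For `1 < p`, with
`σ = w^(1 - p') dμ`, Lerner's argument gives `⟨F⟩_I ^ (p - 1) ≤ C ⟨h⟩_I^ν` with
`h = (M_σ (F / w^(1 - p'))) ^ (p - 1) / w`, and the `L^{p'}(ν)` norm of `h` is controlled by the boundedness of the dyadic maximal
function `M_σ` on `L^p(σ)`.

*Necessity.* Since `N ≥ 1`, adjacent pairs occur in `𝓜^N`. Testing on truncations of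
`w^(1 - p') 1_J`, and for `p = 1` on the indicators of the parts of `J` where `w⁻¹` is large, gives the terms
of the characteristics, because `c_p^b(I, J) / (μ(I) μ(J)^(p-1)) = c_1^b(J, I)^p / μ(J)^p`.
-/

open MeasureTheory Set
open scoped ENNReal NNReal

noncomputable section

namespace BalancedDyadic

/-! ### The dyadic grid -/

namespace DyadicInterval

/-- The dyadic intervals as pairs of integers. -/
def equivProd : DyadicInterval ≃ ℤ × ℤ where
  toFun I := (I.k, I.j)
  invFun q := ⟨q.1, q.2⟩
  left_inv _ := rfl
  right_inv _ := rfl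

instance : Countable DyadicInterval := equivProd.injective.countable

theorem mem_toSet_iff {I : DyadicInterval} {x : ℝ} :
    x ∈ I.toSet ↔ ⌊(2 : ℝ) ^ I.k * x⌋ = I.j := by
  have h2 : (0 : ℝ) < 2 ^ I.k := by positivity
  rw [toSet, mem_Ico, Int.floor_eq_iff, zpow_neg, inv_mul_le_iff₀ h2, lt_inv_mul_iff₀ h2]

theorem measurableSet_toSet (I : DyadicInterval) : MeasurableSet I.toSet := measurableSet_Ico

@[simp] theorem parent_left (I : DyadicInterval) : I.left.parent = I := by
  ext <;> simp [left, parent]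

@[simp] theorem parent_right (I : DyadicInterval) : I.right.parent = I := by
  ext
  · simp [right, parent]
  · simp only [right, parent]
    lia

@[simp] theorem parent_sibling (I : DyadicInterval) : I.sibling.parent = I.parent := by
  ext
  · simp [sibling, parent]
  · simp only [sibling, parent]
    split_ifs <;> lia

@[simp] theorem sibling_sibling (I : DyadicInterval) : I.sibling.sibling = I := by
  ext
  · simp [sibling]
  · simp only [sibling]
    split_ifs <;> lia

theorem eq_left_or_right (I : DyadicInterval) : I = I.parent.left ∨ I = I.parent.right := by
  rcases Int.emod_two_eq_zero_or_one I.j with h | h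
  · left
    ext <;> simp only [left, parent] <;> lia
  · right
    ext <;> simp only [right, parent] <;> lia

theorem eq_left_or_right_of_parent_eq {I K : DyadicInterval} (h : I.parent = K) :
    I = K.left ∨ I = K.right :=
  h ▸ I.eq_left_or_right

theorem eq_or_eq_sibling {I J : DyadicInterval} (h : I.parent = J.parent) :
    I = J ∨ I = J.sibling := by
  have hk : I.k = J.k := by
    have := congrArg DyadicInterval.k h
    simpa [parent] using this
  have hj : I.j / 2 = J.j / 2 := congrArg DyadicInterval.j h
  by_cases hIJ : I.j = J.j
  · exact Or.inl (DyadicInterval.ext hk hIJ)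
  · right
    ext
    · exact hk
    · simp only [sibling]
      split_ifs <;> lia

theorem toSet_subset_parent (I : DyadicInterval) : I.toSet ⊆ I.parent.toSet := by
  intro x hx
  rw [mem_toSet_iff] at hx ⊢
  have h : (2 : ℝ) ^ I.k * x = 2 ^ (I.k - 1) * x * (2 : ℕ) := by
    rw [zpow_sub_one₀ two_ne_zero]
    push_cast
    field_simp
  have := Int.mul_natCast_floor_div_cancel (n := 2) two_ne_zero ((2 : ℝ) ^ (I.k - 1) * x)
  rw [← h, hx] at this
  simpa [parent] using this.symm

theorem toSet_parent_subset (I : DyadicInterval) : I.parent.toSet ⊆ I.toSet ∪ I.sibling.toSet := by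
  intro x hx
  let I' : DyadicInterval := ⟨I.k, ⌊(2 : ℝ) ^ I.k * x⌋⟩
  have hI' : x ∈ I'.toSet := mem_toSet_iff.2 rfl
  have hp : I'.parent = I.parent := by
    have h1 := mem_toSet_iff.1 (toSet_subset_parent I' hI')
    have h2 := mem_toSet_iff.1 hx
    exact DyadicInterval.ext rfl (h1.symm.trans h2)
  rcases eq_or_eq_sibling hp with h | h
  · exact Or.inl (h ▸ hI')
  · exact Or.inr (h ▸ hI')

@[simp] theorem ancestor_zero (I : DyadicInterval) : ancestor 0 I = I := rfl

theorem ancestor_succ (n : ℕ) (I : DyadicInterval) :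
    ancestor (n + 1) I = (ancestor n I).parent :=
  Function.iterate_succ_apply' parent n I

theorem ancestor_succ' (n : ℕ) (I : DyadicInterval) :
    ancestor (n + 1) I = ancestor n I.parent :=
  Function.iterate_succ_apply parent n I

theorem ancestor_add (a b : ℕ) (I : DyadicInterval) :
    ancestor (a + b) I = ancestor a (ancestor b I) :=
  Function.iterate_add_apply parent a b I

theorem ancestor_k (n : ℕ) (I : DyadicInterval) : (ancestor n I).k = I.k - n := by
  induction n with
  | zero => simp
  | succ n ih => rw [ancestor_succ, parent, ih]; push_cast; ring

theorem toSet_subset_ancestor (n : ℕ) (I : DyadicInterval) :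
    I.toSet ⊆ (ancestor n I).toSet := by
  induction n with
  | zero => exact Subset.rfl
  | succ n ih => exact ih.trans (ancestor_succ n I ▸ toSet_subset_parent _)

theorem eq_ancestor_of_mem {I L : DyadicInterval} {x : ℝ} (hI : x ∈ I.toSet) (hL : x ∈ L.toSet)
    (h : L.k ≤ I.k) : ancestor (I.k - L.k).toNat I = L := by
  have hk : (ancestor (I.k - L.k).toNat I).k = L.k := by rw [ancestor_k]; lia
  have h1 := mem_toSet_iff.1 (toSet_subset_ancestor (I.k - L.k).toNat I hI)
  rw [hk, mem_toSet_iff.1 hL] at h1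
  exact DyadicInterval.ext hk h1.symm

/-- The `t`-th generation of dyadic descendants of `K`. -/
def descendants (t : ℕ) (K : DyadicInterval) : Set DyadicInterval := {J | ancestor t J = K}

theorem encard_descendants_le (t : ℕ) (K : DyadicInterval) :
    (descendants t K).encard ≤ 2 ^ t := by
  induction t generalizing K with
  | zero => simp [descendants]
  | succ t ih =>
    have h : descendants (t + 1) K ⊆ descendants t K.left ∪ descendants t K.right := by
      intro J hJ
      have hJ' : (ancestor t J).parent = K := (ancestor_succ t J).symm.trans hJ
      exact eq_left_or_right_of_parent_eq hJ'
    calc _ ≤ _ := encard_le_encard h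
      _ ≤ _ := encard_union_le _ _
      _ ≤ 2 ^ t + 2 ^ t := add_le_add (ih _) (ih _)
      _ = 2 ^ (t + 1) := by ring

/-- The intervals within `n` generations of an ancestor of `I` of order at most `n`. -/
def nearby (n : ℕ) (I : DyadicInterval) : Set DyadicInterval :=
  {J | ∃ s ≤ n, ∃ t ≤ n, ancestor s I = ancestor t J}

theorem mem_nearby_self (n : ℕ) (I : DyadicInterval) : I ∈ nearby n I :=
  ⟨0, Nat.zero_le n, 0, Nat.zero_le n, rfl⟩

/-- A bound for the number of intervals near a given one, uniform in the interval. -/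
theorem exists_encard_nearby_le (n : ℕ) : ∃ c : ℕ, ∀ I, (nearby n I).encard ≤ c := by
  refine ⟨∑ _s ∈ Finset.range (n + 1), ∑ t ∈ Finset.range (n + 1), 2 ^ t, fun I => ?_⟩
  have key : nearby n I ⊆ ⋃ s ∈ Finset.range (n + 1), ⋃ t ∈ Finset.range (n + 1),
      descendants t (ancestor s I) := by
    rintro J ⟨s, hs, t, ht, h⟩
    simp only [mem_iUnion, Finset.mem_range]
    exact ⟨s, by lia, t, by lia, h.symm⟩
  have union_le : ∀ (S : Finset ℕ) (A : ℕ → Set DyadicInterval) (b : ℕ → ℕ),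
      (∀ i, (A i).encard ≤ b i) → (⋃ i ∈ S, A i).encard ≤ ((∑ i ∈ S, b i : ℕ) : ℕ∞) := by
    intro S A b hA
    classical
    induction S using Finset.induction_on with
    | empty => simp
    | insert i S hi ih =>
      rw [Finset.set_biUnion_insert, Finset.sum_insert hi]
      push_cast at ih ⊢
      exact (encard_union_le _ _).trans (add_le_add (hA i) ih)
  refine (encard_le_encard key).trans (union_le _ _ _ fun s => union_le _ _ _ fun t => ?_)
  exact_mod_cast encard_descendants_le t _

theorem exists_ancestor_eq_of_dist_le {I J : DyadicInterval} {n : ℕ} (h : I.dist J ≤ n) :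
    J ∈ nearby n I := by
  have h' : I.dist J < ((n + 1 : ℕ) : ℕ∞) := h.trans_lt (by exact_mod_cast n.lt_succ_self)
  simp only [DyadicInterval.dist, iInf_lt_iff] at h'
  obtain ⟨s, t, hst, hlt⟩ := h'
  have : s + t < n + 1 := by exact_mod_cast hlt
  exact ⟨s, by lia, t, by lia, hst⟩

theorem dist_le_of_ancestor_eq {I J : DyadicInterval} {s t : ℕ}
    (h : ancestor s I = ancestor t J) : I.dist J ≤ (s + t : ℕ) :=
  iInf_le_of_le s (iInf_le_of_le t (iInf_le _ h))

end DyadicInterval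

open DyadicInterval

theorem adjacent_self (I : DyadicInterval) : Adjacent I I := Or.inl (Or.inl rfl)

theorem Adjacent.symm {I J : DyadicInterval} (h : Adjacent I J) : Adjacent J I := by
  unfold Adjacent at h ⊢
  tauto

theorem adjacent_of_parent_eq_sibling {S H : DyadicInterval} (h : H.parent = S.sibling) :
    Adjacent S H :=
  (eq_left_or_right_of_parent_eq h).elim (fun h => Or.inl (Or.inr (Or.inl h)))
    fun h => Or.inl (Or.inr (Or.inr h))

theorem Adjacent.cases {I J : DyadicInterval} (h : Adjacent I J) :
    I = J ∨ J.parent = I.sibling ∨ I.parent = J.sibling := by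
  rcases h with (h | h | h) | h | h <;> simp [h]

theorem Adjacent.exists_ancestor_eq {I J : DyadicInterval} (h : Adjacent I J) (hne : I ≠ J) :
    ∃ s t, s + t = 3 ∧ ancestor s I = ancestor t J := by
  rcases h.cases with h | h | h
  · exact absurd h hne
  · refine ⟨1, 2, rfl, ?_⟩
    rw [ancestor_succ' 1 J, h, ancestor_succ 0, ancestor_succ 0, ancestor_zero, ancestor_zero,
      parent_sibling]
  · refine ⟨2, 1, rfl, ?_⟩
    rw [ancestor_succ' 1 I, h, ancestor_succ 0, ancestor_succ 0, ancestor_zero, ancestor_zero,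
      parent_sibling]

theorem Adjacent.dist_le {I J : DyadicInterval} (h : Adjacent I J) : I.dist J ≤ (3 : ℕ) := by
  by_cases hne : I = J
  · subst hne
    exact (dist_le_of_ancestor_eq (s := 0) (t := 0) rfl).trans (by norm_num)
  · obtain ⟨s, t, hst, h⟩ := h.exists_ancestor_eq hne
    exact hst ▸ dist_le_of_ancestor_eq h

/-! ### Maximal functions over pairs of dyadic intervals -/

/-- The maximal function that spreads the average of `h` over `I` onto `J`, for all pairs `(I, J)`
in the relation `P`. The dyadic maximal function is the case of equality. -/
def pairMaximal (ν : Measure ℝ) (P : DyadicInterval → DyadicInterval → Prop) (h : ℝ → ℝ≥0∞)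
    (x : ℝ) : ℝ≥0∞ :=
  ⨆ (I : DyadicInterval) (J : DyadicInterval) (_ : P I J),
    J.toSet.indicator (fun _ => average ν h I) x

/-- A relation between dyadic intervals is controlled by `ν` if related intervals are close in the
dyadic tree and the second is not much larger than the first. -/
structure Controlled (ν : Measure ℝ) (n : ℕ) (c : ℝ≥0)
    (P : DyadicInterval → DyadicInterval → Prop) : Prop where
  nearby : ∀ {I J}, P I J → J ∈ DyadicInterval.nearby n I
  measure_le : ∀ {I J}, P I J → ν J.toSet ≤ c * ν I.toSet

variable {ν : Measure ℝ} {P : DyadicInterval → DyadicInterval → Prop}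

/-- The relation of equality, which gives the dyadic maximal function of `ν`. -/
theorem controlled_eq (ν : Measure ℝ) : Controlled ν 0 1 Eq where
  nearby := by
    rintro I J rfl
    exact mem_nearby_self 0 I
  measure_le := by
    rintro I J rfl
    simp

theorem measurable_pairMaximal (h : ℝ → ℝ≥0∞) : Measurable (pairMaximal ν P h) :=
  Measurable.iSup fun _ => Measurable.iSup fun J => Measurable.iSup fun _ =>
    measurable_const.indicator J.measurableSet_toSet

theorem average_congr_ae {h h' : ℝ → ℝ≥0∞} (hh : h =ᵐ[ν] h') : average ν h = average ν h' := by
  funext I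
  rw [average, average, lintegral_congr_ae (ae_restrict_of_ae hh)]

theorem pairMaximal_congr_ae {h h' : ℝ → ℝ≥0∞} (hh : h =ᵐ[ν] h') :
    pairMaximal ν P h = pairMaximal ν P h' := by
  funext x
  simp only [pairMaximal, average_congr_ae hh]

theorem average_le_pairMaximal {I J : DyadicInterval} (hIJ : P I J) (h : ℝ → ℝ≥0∞) {x : ℝ}
    (hx : x ∈ J.toSet) : average ν h I ≤ pairMaximal ν P h x :=
  le_iSup_of_le I <| le_iSup_of_le J <| le_iSup_of_le hIJ <| by rw [indicator_of_mem hx]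

theorem pairMaximal_le {h : ℝ → ℝ≥0∞} {x : ℝ} {b : ℝ≥0∞}
    (H : ∀ I J, P I J → x ∈ J.toSet → average ν h I ≤ b) : pairMaximal ν P h x ≤ b :=
  iSup_le fun I => iSup_le fun J => iSup_le fun hIJ =>
    indicator_apply_le' (fun hx => H I J hIJ hx) fun _ => zero_le

theorem lt_pairMaximal_iff {h : ℝ → ℝ≥0∞} {x : ℝ} {a : ℝ≥0∞} :
    a < pairMaximal ν P h x ↔ ∃ I J, P I J ∧ x ∈ J.toSet ∧ a < average ν h I := by
  simp only [pairMaximal, lt_iSup_iff, exists_prop]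
  refine exists_congr fun I => exists_congr fun J => and_congr_right fun _ => ?_
  by_cases hx : x ∈ J.toSet <;> simp [hx]

/-- Among finitely many dyadic intervals, every one has an ancestor that is maximal. -/
theorem exists_maximal_ancestor (S : Finset DyadicInterval) {I : DyadicInterval} (hI : I ∈ S) :
    ∃ L ∈ S, (∃ a, ancestor a I = L) ∧ ∀ a, ancestor a L ∈ S → ancestor a L = L := by
  classical
  obtain ⟨L, hL, hmin⟩ := Finset.exists_min_image (S.filter fun L => ∃ a, ancestor a I = L)
    DyadicInterval.k ⟨I, Finset.mem_filter.2 ⟨hI, 0, rfl⟩⟩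
  obtain ⟨hLS, a, rfl⟩ := Finset.mem_filter.1 hL
  refine ⟨_, hLS, ⟨a, rfl⟩, fun b hb => ?_⟩
  have := hmin _ (Finset.mem_filter.2 ⟨hb, b + a, ancestor_add b a I⟩)
  rw [ancestor_k b] at this
  obtain rfl : b = 0 := by lia
  rfl

/-- If `I` has the ancestor `L` and `J` is near `I`, then `J` is contained in `L` or near `L`. This
is why passing to maximal intervals loses only a bounded number of intervals `J`. -/
theorem subset_or_mem_nearby {n a : ℕ} {I J L : DyadicInterval} (hJ : J ∈ nearby n I)
    (hL : ancestor a I = L) : J.toSet ⊆ L.toSet ∨ J ∈ nearby n L := by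
  obtain ⟨s, hs, t, ht, hst⟩ := hJ
  rcases le_total s a with h | h
  · left
    have : ancestor (a - s + t) J = L := by
      rw [ancestor_add, ← hst, ← ancestor_add, Nat.sub_add_cancel h, hL]
    exact this ▸ toSet_subset_ancestor _ J
  · right
    refine ⟨s - a, by lia, t, ht, ?_⟩
    rw [← hst, ← hL, ← ancestor_add, Nat.sub_add_cancel h]

theorem disjoint_of_maximal {S : Set DyadicInterval}
    (hS : ∀ L ∈ S, ∀ a, ancestor a L ∈ S → ancestor a L = L) :
    S.PairwiseDisjoint DyadicInterval.toSet := by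
  intro L hL L' hL' hne
  rw [Function.onFun, Set.disjoint_left]
  intro x hx hx'
  rcases le_total L.k L'.k with h | h
  · have := eq_ancestor_of_mem hx' hx h
    exact hne (this.symm.trans (hS L' hL' _ (this.symm ▸ hL)))
  · have := eq_ancestor_of_mem hx hx' h
    exact hne (this.symm.trans (hS L hL _ (this.symm ▸ hL'))).symm

/-- The weak type estimate for finitely many pairs: cover the second intervals by the maximal first
intervals and by their neighbours of controlled measure. -/
theorem exists_measure_finset_le (n : ℕ) (c : ℝ≥0) : ∃ K : ℝ≥0, ∀ (ν : Measure ℝ)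
    (P : DyadicInterval → DyadicInterval → Prop), Controlled ν n c P →
    ∀ (h : ℝ → ℝ≥0∞) (a : ℝ≥0∞) (F : Finset (DyadicInterval × DyadicInterval)),
    (∀ q ∈ F, P q.1 q.2 ∧ a * ν q.1.toSet ≤ ∫⁻ x in q.1.toSet, h x ∂ν) →
    a * ν (⋃ q ∈ F, q.2.toSet) ≤ K * ∫⁻ x, h x ∂ν := by
  classical
  obtain ⟨d, hd⟩ := exists_encard_nearby_le n
  refine ⟨1 + d * c, fun ν P hP h a F hF => ?_⟩
  set S := F.image Prod.fst
  set T := S.filter fun L => ∀ a, ancestor a L ∈ S → ancestor a L = L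
  set B : DyadicInterval → Set DyadicInterval := fun L =>
    {J | J ∈ nearby n L ∧ ν J.toSet ≤ c * ν L.toSet}
  have hB : ∀ L, (B L).encard ≤ d := fun L => (encard_le_encard fun J hJ => hJ.1).trans (hd L)
  have hfin : ∀ L, (B L).Finite := fun L => Set.finite_of_encard_le_coe (hB L)
  have hcover : (⋃ q ∈ F, q.2.toSet) ⊆ ⋃ L ∈ T, (L.toSet ∪ ⋃ J ∈ (hfin L).toFinset, J.toSet) := by
    refine iUnion₂_subset fun q hq x hx => ?_
    obtain ⟨L, hLS, ⟨b, hb⟩, hmax⟩ := exists_maximal_ancestor S (Finset.mem_image_of_mem _ hq)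
    refine mem_biUnion (x := L) (Finset.mem_filter.2 ⟨hLS, hmax⟩) ?_
    rcases subset_or_mem_nearby (hP.nearby (hF q hq).1) hb with hsub | hnear
    · exact Or.inl (hsub hx)
    · refine Or.inr (mem_biUnion (x := q.2) ?_ hx)
      simp only [Finite.coe_toFinset]
      refine ⟨hnear, (hP.measure_le (hF q hq).1).trans ?_⟩
      gcongr
      exact hb ▸ toSet_subset_ancestor b q.1
  have hpiece : ∀ L, ν (L.toSet ∪ ⋃ J ∈ (hfin L).toFinset, J.toSet) ≤ (1 + d * c) * ν L.toSet := by
    intro L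
    have hcard : (hfin L).toFinset.card ≤ d := by
      have := hB L
      rw [(hfin L).encard_eq_coe_toFinset_card] at this
      exact_mod_cast this
    calc _ ≤ ν L.toSet + ∑ J ∈ (hfin L).toFinset, ν J.toSet :=
          (measure_union_le _ _).trans (by gcongr; exact measure_biUnion_finset_le _ _)
      _ ≤ ν L.toSet + (hfin L).toFinset.card • (c * ν L.toSet) := by
          gcongr
          refine Finset.sum_le_card_nsmul _ _ _ fun J hJ => ?_
          exact ((hfin L).mem_toFinset.1 hJ).2
      _ ≤ ν L.toSet + d * (c * ν L.toSet) := by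
          rw [nsmul_eq_mul]
          gcongr
      _ = _ := by ring
  calc a * ν (⋃ q ∈ F, q.2.toSet)
      ≤ a * ∑ L ∈ T, (1 + d * c) * ν L.toSet := by
        gcongr
        refine (measure_mono hcover).trans ((measure_biUnion_finset_le _ _).trans ?_)
        exact Finset.sum_le_sum fun L _ => hpiece L
    _ = (1 + d * c) * ∑ L ∈ T, a * ν L.toSet := by
        rw [← Finset.mul_sum, ← Finset.mul_sum]
        ring
    _ ≤ (1 + d * c) * ∑ L ∈ T, ∫⁻ x in L.toSet, h x ∂ν := by
        gcongr with L hL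
        obtain ⟨q, hq, rfl⟩ := Finset.mem_image.1 (Finset.mem_filter.1 hL).1
        exact (hF q hq).2
    _ = (1 + d * c) * ∫⁻ x in ⋃ L ∈ T, L.toSet, h x ∂ν := by
        rw [lintegral_biUnion_finset _ fun L _ => L.measurableSet_toSet]
        refine disjoint_of_maximal fun L hL b hb => ?_
        exact (Finset.mem_filter.1 hL).2 b (Finset.mem_filter.1 hb).1
    _ ≤ _ := by
        push_cast
        gcongr
        exact Measure.restrict_le_self

/-- Maximal functions over controlled pairs are of weak type `(1, 1)`. -/
theorem exists_weakType_pairMaximal (n : ℕ) (c : ℝ≥0) : ∃ K : ℝ≥0, ∀ (ν : Measure ℝ)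
    (P : DyadicInterval → DyadicInterval → Prop), Controlled ν n c P →
    ∀ (h : ℝ → ℝ≥0∞) (a : ℝ≥0∞),
    a * ν {x | a < pairMaximal ν P h x} ≤ K * ∫⁻ x, h x ∂ν := by
  obtain ⟨K, hK⟩ := exists_measure_finset_le n c
  refine ⟨K, fun ν P hP h a => ?_⟩
  set Q : Set (DyadicInterval × DyadicInterval) := {q | P q.1 q.2 ∧ a < average ν h q.1}
  have hset : {x | a < pairMaximal ν P h x} = ⋃ q : Q, q.1.2.toSet := by
    ext x
    simp only [mem_ofPred_eq, lt_pairMaximal_iff, mem_iUnion, Subtype.exists, Prod.exists, Q]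
    exact exists_congr fun I => exists_congr fun J => by tauto
  -- The pairs are exhausted by finite sets, for which maximal intervals exist.
  have hdir : Directed (· ⊆ ·) fun F : Finset Q => ⋃ q ∈ F, q.1.2.toSet :=
    directed_of_isDirected_le fun s t hst => biUnion_mono hst fun _ _ => Subset.rfl
  rw [hset, Set.iUnion_eq_iUnion_finset, hdir.measure_iUnion, ENNReal.mul_iSup]
  refine iSup_le fun F => ?_
  classical
  have := hK ν P hP h a (F.image Subtype.val) fun q hq => by
    obtain ⟨q', -, rfl⟩ := Finset.mem_image.1 hq
    exact ⟨q'.2.1, ENNReal.mul_le_of_le_div q'.2.2.le⟩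
  rwa [Finset.set_biUnion_finset_image] at this

/-- Truncating `h` at height `a` changes the maximal function by at most `a`. -/
theorem pairMaximal_le_add_of_truncation (h : ℝ → ℝ≥0∞) (a : ℝ≥0∞) (x : ℝ) :
    pairMaximal ν P h x ≤ pairMaximal ν P ({y | a < h y}.indicator h) x + a := by
  refine pairMaximal_le fun I J hIJ hx => ?_
  refine le_trans ?_ (add_le_add_left (average_le_pairMaximal hIJ _ hx) a)
  have hle : ∀ y, h y ≤ {y | a < h y}.indicator h y + a := by
    intro y
    by_cases hy : a < h y
    · simp [hy]
    · simpa [hy] using not_lt.1 hy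
  calc average ν h I
      ≤ (∫⁻ y in I.toSet, ({y | a < h y}.indicator h y + a) ∂ν) / ν I.toSet := by
        unfold average
        gcongr with y
        exact hle y
    _ = average ν ({y | a < h y}.indicator h) I + a * ν I.toSet / ν I.toSet := by
        rw [lintegral_add_right _ measurable_const, setLIntegral_const, ENNReal.add_div, average]
    _ ≤ _ := by
        gcongr
        exact ENNReal.div_le_of_le_mul le_rfl

/-- The layer cake formula for a single value in `[0, ∞]`. -/
theorem lintegral_layer (x : ℝ≥0∞) {r : ℝ} (hr : 0 < r) :
    ENNReal.ofReal r * ∫⁻ t in Ioi (0 : ℝ),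
      {t : ℝ | ENNReal.ofReal t < x}.indicator (fun t => ENNReal.ofReal (t ^ (r - 1))) t
        = x ^ r := by
  have hfin : ∀ y : ℝ≥0, ENNReal.ofReal r * ∫⁻ t in Ioi (0 : ℝ),
      {t : ℝ | ENNReal.ofReal t < y}.indicator (fun t => ENNReal.ofReal (t ^ (r - 1))) t
        = (y : ℝ≥0∞) ^ r := by
    intro y
    have key := lintegral_rpow_eq_lintegral_meas_lt_mul (Measure.dirac ()) (f := fun _ => (y : ℝ))
      (Filter.Eventually.of_forall fun _ => y.2) aemeasurable_const hr
    rw [lintegral_const, measure_univ, mul_one, ← ENNReal.ofReal_rpow_of_nonneg y.coe_nonneg hr.le,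
      ENNReal.ofReal_coe_nnreal] at key
    rw [key]
    congr 1
    refine setLIntegral_congr_fun measurableSet_Ioi fun t ht => ?_
    have hiff : ENNReal.ofReal t < y ↔ t < (y : ℝ) := by
      rw [← ENNReal.ofReal_coe_nnreal, ENNReal.ofReal_lt_ofReal_iff_of_nonneg (le_of_lt ht)]
    by_cases h : t < (y : ℝ) <;> simp [hiff, h]
  induction x with
  | coe y => exact hfin y
  | top =>
    rw [ENNReal.top_rpow_of_pos hr, eq_top_iff]
    refine ENNReal.le_of_forall_nnreal_lt fun b _ => ?_
    have hb : (b : ℝ≥0∞) = ((b ^ r⁻¹ : ℝ≥0) : ℝ≥0∞) ^ r := by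
      rw [← ENNReal.coe_rpow_of_nonneg _ hr.le, ← NNReal.rpow_mul, inv_mul_cancel₀ hr.ne',
        NNReal.rpow_one]
    rw [hb, ← hfin]
    refine mul_le_mul_right (lintegral_mono fun t => ?_) _
    rw [indicator_of_mem (s := {t : ℝ | ENNReal.ofReal t < ∞}) ENNReal.ofReal_lt_top]
    exact indicator_apply_le' (fun _ => le_rfl) fun _ => zero_le

/-- A form of the Marcinkiewicz interpolation theorem: a truncated weak type `(1, 1)` inequality
implies a strong type `(q, q)` inequality. -/
theorem lintegral_rpow_le_of_truncated_weakType {q : ℝ} (hq : 1 < q) (K : ℝ≥0) {ν : Measure ℝ}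
    [SFinite ν] {u h : ℝ → ℝ≥0∞} (hu : Measurable u) (hh : Measurable h)
    (H : ∀ a : ℝ, 0 < a → ENNReal.ofReal a * ν {x | ENNReal.ofReal a < u x} ≤
      K * ∫⁻ x, {x | ENNReal.ofReal a < 2 * h x}.indicator h x ∂ν) :
    ∫⁻ x, u x ^ q ∂ν ≤
      (ENNReal.ofReal q * K * (ENNReal.ofReal (q - 1))⁻¹ * 2 ^ (q - 1)) * ∫⁻ x, h x ^ q ∂ν := by
  have hq0 : 0 < q := by linarith
  have hq1 : 0 < q - 1 := by linarith
  have meas : MeasurableSet {z : ℝ × ℝ | ENNReal.ofReal z.2 < u z.1} :=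
    measurableSet_lt (by fun_prop) (by fun_prop)
  have layer2 : ∀ x : ℝ≥0∞, ∫⁻ t in Ioi (0 : ℝ),
      {t : ℝ | ENNReal.ofReal t < x}.indicator (fun t => ENNReal.ofReal (t ^ (q - 2))) t
        = (ENNReal.ofReal (q - 1))⁻¹ * x ^ (q - 1) := by
    intro x
    have h0 : ENNReal.ofReal (q - 1) ≠ 0 := by simpa using hq1
    rw [← lintegral_layer x hq1, ← mul_assoc, ENNReal.inv_mul_cancel h0 ENNReal.ofReal_ne_top,
      one_mul]
    simp only [show q - 1 - 1 = q - 2 by ring]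
  calc ∫⁻ x, u x ^ q ∂ν
      = ENNReal.ofReal q * ∫⁻ x, (∫⁻ t in Ioi (0 : ℝ), {t : ℝ | ENNReal.ofReal t < u x}.indicator
          (fun t => ENNReal.ofReal (t ^ (q - 1))) t) ∂ν := by
        rw [← lintegral_const_mul' _ _ ENNReal.ofReal_ne_top]
        exact lintegral_congr fun x => (lintegral_layer (u x) hq0).symm
    _ = ENNReal.ofReal q * ∫⁻ t in Ioi (0 : ℝ), (∫⁻ x, {t : ℝ | ENNReal.ofReal t < u x}.indicator
          (fun t => ENNReal.ofReal (t ^ (q - 1))) t ∂ν) := by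
        rw [lintegral_lintegral_swap]
        refine Measurable.aemeasurable ?_
        exact Measurable.indicator (f := fun z : ℝ × ℝ => ENNReal.ofReal (z.2 ^ (q - 1)))
          (by fun_prop) meas
    _ = ENNReal.ofReal q * ∫⁻ t in Ioi (0 : ℝ),
          ENNReal.ofReal (t ^ (q - 1)) * ν {x | ENNReal.ofReal t < u x} := by
        congr 1
        refine lintegral_congr fun t => ?_
        rw [← lintegral_indicator_const (measurableSet_lt measurable_const hu)]
        rfl
    _ ≤ ENNReal.ofReal q * ∫⁻ t in Ioi (0 : ℝ), ENNReal.ofReal (t ^ (q - 2)) *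
          (K * ∫⁻ x, {x | ENNReal.ofReal t < 2 * h x}.indicator h x ∂ν) := by
        gcongr ENNReal.ofReal q * ?_
        refine setLIntegral_mono' measurableSet_Ioi fun t ht => ?_
        rw [mem_Ioi] at ht
        have hpow : t ^ (q - 1) = t ^ (q - 2) * t := by
          rw [← Real.rpow_add_one ht.ne']
          ring_nf
        rw [hpow, ENNReal.ofReal_mul (by positivity), mul_assoc]
        gcongr ENNReal.ofReal (t ^ (q - 2)) * ?_
        exact H t ht
    _ = ENNReal.ofReal q * (K * ∫⁻ t in Ioi (0 : ℝ), (∫⁻ x, h x *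
          {t : ℝ | ENNReal.ofReal t < 2 * h x}.indicator
            (fun t => ENNReal.ofReal (t ^ (q - 2))) t ∂ν)) := by
        rw [← lintegral_const_mul' _ _ ENNReal.coe_ne_top]
        congr 1
        refine lintegral_congr fun t => ?_
        rw [mul_left_comm, ← lintegral_const_mul' _ _ ENNReal.ofReal_ne_top]
        congr 1
        refine lintegral_congr fun x => ?_
        by_cases hx : ENNReal.ofReal t < 2 * h x
        · simp only [indicator, mem_ofPred_eq, hx, if_true]
          exact mul_comm _ _
        · simp only [indicator, mem_ofPred_eq, hx, if_false, mul_zero]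
    _ = ENNReal.ofReal q * (K * ∫⁻ x, (∫⁻ t in Ioi (0 : ℝ), h x *
          {t : ℝ | ENNReal.ofReal t < 2 * h x}.indicator
            (fun t => ENNReal.ofReal (t ^ (q - 2))) t) ∂ν) := by
        rw [lintegral_lintegral_swap]
        refine Measurable.aemeasurable (Measurable.mul (by fun_prop) ?_)
        exact Measurable.indicator (f := fun z : ℝ × ℝ => ENNReal.ofReal (z.1 ^ (q - 2)))
          (by fun_prop) (measurableSet_lt (by fun_prop) (by fun_prop))
    _ = ENNReal.ofReal q * (K * ∫⁻ x, ((ENNReal.ofReal (q - 1))⁻¹ * 2 ^ (q - 1)) * h x ^ q ∂ν) := by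
        congr 2
        refine lintegral_congr fun x => ?_
        rw [lintegral_const_mul _ (Measurable.indicator (by fun_prop)
          (measurableSet_lt (by fun_prop) measurable_const)), layer2,
          ENNReal.mul_rpow_of_nonneg _ _ hq1.le]
        have hpow : h x ^ q = h x * h x ^ (q - 1) := by
          conv_rhs => rw [← ENNReal.rpow_one (h x), ← ENNReal.rpow_mul, one_mul]
          rw [← ENNReal.rpow_add_of_nonneg _ _ zero_le_one hq1.le]
          ring_nf
        rw [hpow]
        ring
    _ = _ := by
        rw [lintegral_const_mul _ (by fun_prop)]
        ring

/-- Maximal functions over controlled pairs are of strong type `(q, q)`. -/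
theorem exists_strongType_pairMaximal (n : ℕ) (c : ℝ≥0) {q : ℝ} (hq : 1 < q) : ∃ K : ℝ≥0,
    ∀ (ν : Measure ℝ) [SFinite ν] (P : DyadicInterval → DyadicInterval → Prop),
    Controlled ν n c P → ∀ h : ℝ → ℝ≥0∞, AEMeasurable h ν →
    ∫⁻ x, pairMaximal ν P h x ^ q ∂ν ≤ K * ∫⁻ x, h x ^ q ∂ν := by
  obtain ⟨K, hK⟩ := exists_weakType_pairMaximal n c
  have hq1 : 0 < q - 1 := by linarith
  have hC : ENNReal.ofReal q * (2 * K : ℝ≥0) * (ENNReal.ofReal (q - 1))⁻¹ * 2 ^ (q - 1) ≠ ∞ := by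
    refine ENNReal.mul_ne_top (ENNReal.mul_ne_top (ENNReal.mul_ne_top ?_ ?_) ?_) ?_
    · exact ENNReal.ofReal_ne_top
    · exact ENNReal.coe_ne_top
    · exact ENNReal.inv_ne_top.2 (by simpa using hq1)
    · exact ENNReal.rpow_ne_top_of_nonneg hq1.le ENNReal.ofNat_ne_top
  refine ⟨(ENNReal.ofReal q * (2 * K : ℝ≥0) * (ENNReal.ofReal (q - 1))⁻¹ * 2 ^ (q - 1)).toNNReal,
    fun ν _ P hP h hh => ?_⟩
  rw [ENNReal.coe_toNNReal hC, pairMaximal_congr_ae hh.ae_eq_mk,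
    lintegral_congr_ae (f := fun x => h x ^ q) (hh.ae_eq_mk.fun_comp (· ^ q))]
  refine lintegral_rpow_le_of_truncated_weakType hq (2 * K) (measurable_pairMaximal _)
    hh.measurable_mk fun a ha => ?_
  generalize hh.mk h = g
  -- Truncation at half the level costs half of the level.
  set b := ENNReal.ofReal (a / 2)
  have hab : ENNReal.ofReal a = 2 * b := by
    rw [← ENNReal.ofReal_ofNat, ← ENNReal.ofReal_mul zero_le_two]
    ring_nf
  have hiff : ∀ y, ENNReal.ofReal a < 2 * g y ↔ b < g y := fun y => by
    rw [hab, ENNReal.mul_lt_mul_iff_right two_ne_zero ENNReal.ofNat_ne_top]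
  simp only [hiff]
  calc ENNReal.ofReal a * ν {x | ENNReal.ofReal a < pairMaximal ν P g x}
      ≤ 2 * (b * ν {x | b < pairMaximal ν P ({y | b < g y}.indicator g) x}) := by
        rw [hab, mul_assoc]
        refine mul_le_mul_right (mul_le_mul_right (measure_mono fun x hx => ?_) _) _
        have := (mem_ofPred_eq ▸ hx).trans_le (pairMaximal_le_add_of_truncation g b x)
        rw [two_mul] at this
        exact lt_of_add_lt_add_right this
    _ ≤ 2 * (K * ∫⁻ x, {y | b < g y}.indicator g x ∂ν) := by
        gcongr 2 * ?_
        exact hK ν P hP _ b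
    _ = _ := by
        push_cast
        ring

/-! ### Balanced measures -/

variable {μ : Measure ℝ}

theorem measure_toSet_ne_top [IsLocallyFiniteMeasure μ] (I : DyadicInterval) : μ I.toSet ≠ ∞ :=
  measure_Ico_lt_top.ne

theorem measure_ancestor_mono (μ : Measure ℝ) (n : ℕ) (I : DyadicInterval) :
    μ I.toSet ≤ μ (ancestor n I).toSet :=
  measure_mono (toSet_subset_ancestor n I)

theorem measure_parent_le (μ : Measure ℝ) (I : DyadicInterval) :
    μ I.parent.toSet ≤ μ I.toSet + μ I.sibling.toSet :=
  (measure_mono (toSet_parent_subset I)).trans (measure_union_le _ _)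

theorem m_le_measure (I : DyadicInterval) : m μ I ≤ μ I.toSet := by
  have hl : μ I.left.toSet ≤ μ I.toSet := by
    simpa using measure_mono (toSet_subset_parent I.left)
  have hr : μ I.right.toSet ≤ μ I.toSet := by
    simpa using measure_mono (toSet_subset_parent I.right)
  exact ENNReal.div_le_of_le_mul (mul_le_mul' hl hr)

theorem m_parent (I : DyadicInterval) :
    m μ I.parent = μ I.toSet * μ I.sibling.toSet / μ I.parent.toSet := by
  have h : I.sibling = I.parent.left ∨ I.sibling = I.parent.right :=
    eq_left_or_right_of_parent_eq (parent_sibling I)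
  have hne : I ≠ I.sibling := by
    intro h
    have := congrArg DyadicInterval.j h
    simp only [sibling] at this
    split_ifs at this <;> lia
  rw [m]
  rcases I.eq_left_or_right with hI | hI <;> rcases h with h | h
  · exact absurd (hI.trans h.symm) hne
  · rw [← hI, ← h]
  · rw [← hI, ← h, mul_comm]
  · exact absurd (hI.trans h.symm) hne

/-- The smaller of two siblings has measure comparable to `m` of the parent. -/
theorem measure_le_two_mul_m_parent [IsLocallyFiniteMeasure μ] {S : DyadicInterval}
    (hS : μ S.toSet ≤ μ S.sibling.toSet) : μ S.toSet ≤ 2 * m μ S.parent := by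
  rcases eq_or_ne (μ S.sibling.toSet) 0 with h0 | h0
  · exact (hS.trans h0.le).trans zero_le
  have hp : μ S.parent.toSet ≤ 2 * μ S.sibling.toSet := by
    rw [two_mul]
    exact (measure_parent_le μ S).trans (by gcongr)
  have hp0 : μ S.parent.toSet ≠ 0 := by
    refine (pos_iff_ne_zero.2 h0).trans_le (measure_mono ?_) |>.ne'
    exact parent_sibling S ▸ toSet_subset_parent S.sibling
  rw [m_parent, ← mul_div_assoc, ENNReal.le_div_iff_mul_le (Or.inl hp0)
    (Or.inl (measure_toSet_ne_top _))]
  calc _ ≤ μ S.toSet * (2 * μ S.sibling.toSet) := by gcongr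
    _ = _ := by ring

/-- The two inequalities between `m` of an interval and of its parent, with a fixed constant. -/
def BalancedWith (μ : Measure ℝ) (C : ℝ≥0) : Prop :=
  1 ≤ C ∧ ∀ I : DyadicInterval, m μ I ≤ C * m μ I.parent ∧ m μ I.parent ≤ C * m μ I

theorem IsBalanced.exists_balancedWith (hμ : IsBalanced μ) : ∃ C, BalancedWith μ C := by
  obtain ⟨C, hC⟩ := hμ.comparable
  refine ⟨max 1 C, le_max_left _ _, fun I => ⟨(hC I).1.trans ?_, (hC I).2.trans ?_⟩⟩ <;>
    gcongr <;> exact le_max_right _ _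

namespace BalancedWith

variable {C : ℝ≥0} (hC : BalancedWith μ C)
include hC

theorem m_le_ancestor (n : ℕ) (I : DyadicInterval) : m μ I ≤ C ^ n * m μ (ancestor n I) := by
  induction n with
  | zero => simp
  | succ n ih =>
    calc _ ≤ _ := ih
      _ ≤ C ^ n * (C * m μ (ancestor (n + 1) I)) := by
          rw [ancestor_succ]
          gcongr
          exact (hC.2 _).1
      _ = _ := by ring

theorem m_ancestor_le (n : ℕ) (I : DyadicInterval) : m μ (ancestor n I) ≤ C ^ n * m μ I := by
  induction n with
  | zero => simp
  | succ n ih =>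
    calc _ ≤ C * m μ (ancestor n I) := by
          rw [ancestor_succ]
          exact (hC.2 _).2
      _ ≤ C * (C ^ n * m μ I) := by gcongr
      _ = _ := by ring

theorem m_le_of_ancestor_eq {s t : ℕ} {I J : DyadicInterval} (h : ancestor s I = ancestor t J) :
    m μ I ≤ C ^ (s + t) * m μ J := by
  calc m μ I ≤ C ^ s * m μ (ancestor s I) := hC.m_le_ancestor s I
    _ ≤ C ^ s * (C ^ t * m μ J) := by
        rw [h]
        gcongr
        exact hC.m_ancestor_le t J
    _ = _ := by ring

theorem sqrt_m_mul_sqrt_m_le {s t : ℕ} {I J : DyadicInterval}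
    (h : ancestor s I = ancestor t J) :
    m μ I ^ (1 / 2 : ℝ) * m μ J ^ (1 / 2 : ℝ) ≤ C ^ (s + t) * m μ J := by
  have h1 : (1 : ℝ≥0∞) ≤ (C : ℝ≥0∞) ^ (s + t) := one_le_pow₀ (by exact_mod_cast hC.1)
  calc _ ≤ (C ^ (s + t) * m μ J) ^ (1 / 2 : ℝ) * (C ^ (s + t) * m μ J) ^ (1 / 2 : ℝ) := by
        gcongr
        · exact hC.m_le_of_ancestor_eq h
        · exact le_mul_of_one_le_left' h1
    _ = _ := by
        rw [← ENNReal.rpow_add_of_nonneg _ _ (by norm_num) (by norm_num)]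
        norm_num

theorem measure_le_m_of_light [IsLocallyFiniteMeasure μ] {S : DyadicInterval} {t : ℕ}
    {J : DyadicInterval} (hS : μ S.toSet ≤ μ S.sibling.toSet) (hJ : ancestor t J = S) :
    μ S.toSet ≤ (2 * C ^ (t + 1) : ℝ≥0) * m μ J := by
  calc μ S.toSet ≤ 2 * m μ S.parent := measure_le_two_mul_m_parent hS
    _ ≤ 2 * (C ^ (t + 1) * m μ J) := by
        gcongr
        rw [← hJ, ← ancestor_succ]
        exact hC.m_ancestor_le _ _
    _ = _ := by
        push_cast
        ring

end BalancedWith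

/-! ### Measures adapted to a balanced measure -/

/-- The consequences of the `A_p^b` conditions for the measure `ν = w dμ` that do not mention the
dual weight: it satisfies the ratio inequality for nested intervals, and an interval `I` with `μ I`
comparable to `m I` has, up to a constant, at most the `ν`-measure of the adjacent intervals. -/
structure Adapted (μ ν : Measure ℝ) (p : ℝ) (A : ℝ≥0) : Prop where
  ac : ν ≪ μ
  ancestor_le : ∀ (a : ℕ) (I : DyadicInterval),
    μ I.toSet ^ p * ν (ancestor a I).toSet ≤ A * μ (ancestor a I).toSet ^ p * ν I.toSet
  adjacent_le : ∀ {I J : DyadicInterval}, I ≠ J → Adjacent I J →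
    m μ I ^ p * ν I.toSet ≤ A * μ I.toSet ^ p * ν J.toSet

/-- Cancellation of `x ^ p` in the inequalities of `Adapted` when `y` is at most `D * x`. -/
theorem le_mul_of_rpow_mul_le {p : ℝ} (hp : 0 ≤ p) {x y a b : ℝ≥0∞} {A D : ℝ≥0}
    (h : x ^ p * a ≤ A * y ^ p * b) (hy : y ≤ D * x) (h0 : x ≠ 0) (ht : x ≠ ∞) :
    a ≤ (A * D ^ p : ℝ≥0) * b := by
  have h0' : x ^ p ≠ 0 := by
    simp [ENNReal.rpow_eq_zero_iff, h0, ht]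
  refine (ENNReal.mul_le_mul_iff_right h0' (ENNReal.rpow_ne_top_of_nonneg hp ht)).1 (h.trans ?_)
  calc A * y ^ p * b ≤ A * (D * x) ^ p * b := by gcongr
    _ = _ := by
        rw [ENNReal.mul_rpow_of_nonneg _ _ hp, ENNReal.coe_mul, ENNReal.coe_rpow_of_nonneg _ hp]
        ring

theorem le_const_mul_of_le {x y : ℝ≥0∞} {k K : ℝ≥0} (h : x ≤ k * y) (hk : k ≤ K) : x ≤ K * y :=
  h.trans (by gcongr)

theorem ne_of_parent_eq_sibling {S H : DyadicInterval} (h : H.parent = S.sibling) : S ≠ H := by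
  rintro rfl
  have := congrArg DyadicInterval.k h
  simp [parent, sibling] at this

namespace Adapted

variable {p : ℝ} {A : ℝ≥0}

theorem measure_ancestor_le [IsLocallyFiniteMeasure μ] (hν : Adapted μ ν p A) (hp : 0 ≤ p)
    {D : ℝ≥0} {a : ℕ} {I L : DyadicInterval} (hL : ancestor a I = L)
    (h : μ L.toSet ≤ D * μ I.toSet) : ν L.toSet ≤ (A * D ^ p : ℝ≥0) * ν I.toSet := by
  subst hL
  rcases eq_or_ne (μ I.toSet) 0 with h0 | h0
  · rw [h0, mul_zero, nonpos_iff_eq_zero] at h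
    rw [hν.ac h]
    exact zero_le
  · exact le_mul_of_rpow_mul_le hp (hν.ancestor_le a I) h h0 (measure_toSet_ne_top I)

theorem measure_adjacent_le [IsLocallyFiniteMeasure μ] (hν : Adapted μ ν p A) (hp : 0 ≤ p)
    {D : ℝ≥0} {I J : DyadicInterval} (hne : I ≠ J) (hIJ : Adjacent I J)
    (h : μ I.toSet ≤ D * m μ I) : ν I.toSet ≤ (A * D ^ p : ℝ≥0) * ν J.toSet := by
  rcases eq_or_ne (m μ I) 0 with h0 | h0
  · rw [h0, mul_zero, nonpos_iff_eq_zero] at h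
    rw [hν.ac h]
    exact zero_le
  · exact le_mul_of_rpow_mul_le hp (hν.adjacent_le hne hIJ) h h0
      (ne_top_of_le_ne_top (measure_toSet_ne_top I) (m_le_measure I))

/-- Two smaller siblings `S` and `H`, where `H` is a child of the sibling of `S`, have comparable
`ν`-measure. -/
theorem comparable_light [IsLocallyFiniteMeasure μ] (hν : Adapted μ ν p A) (hp : 0 ≤ p) {C : ℝ≥0}
    (hC : BalancedWith μ C) {S H : DyadicInterval} (h : H.parent = S.sibling)
    (hS : μ S.toSet ≤ μ S.sibling.toSet) (hH : μ H.toSet ≤ μ H.sibling.toSet) :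
    ν S.toSet ≤ (A * (2 * C ^ (0 + 1)) ^ p : ℝ≥0) * ν H.toSet ∧
      ν H.toSet ≤ (A * (2 * C ^ (0 + 1)) ^ p : ℝ≥0) * ν S.toSet := by
  have hne := ne_of_parent_eq_sibling h
  have hadj := adjacent_of_parent_eq_sibling h
  exact ⟨hν.measure_adjacent_le hp hne hadj (hC.measure_le_m_of_light hS rfl),
    hν.measure_adjacent_le hp hne.symm hadj.symm (hC.measure_le_m_of_light hH rfl)⟩

theorem light_le_descendant [IsLocallyFiniteMeasure μ] (hν : Adapted μ ν p A) (hp : 0 ≤ p)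
    {C : ℝ≥0} (hC : BalancedWith μ C) {S J : DyadicInterval} {t : ℕ} (hJ : ancestor t J = S)
    (hS : μ S.toSet ≤ μ S.sibling.toSet) :
    ν S.toSet ≤ (A * (2 * C ^ (t + 1)) ^ p : ℝ≥0) * ν J.toSet :=
  hν.measure_ancestor_le hp hJ <| (hC.measure_le_m_of_light hS hJ).trans <| by
    gcongr
    exact m_le_measure J

/-- If `S` is the smaller sibling, a descendant `J` of its sibling either carries a fixed proportion
of the measure of that sibling, or has `ν`-measure comparable to that of `S`. The path down to `J`
is followed as long as it takes the larger child; each step replaces `S` by the smaller child, which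
is adjacent to the previous `S`. -/
theorem exists_comparable_light [IsLocallyFiniteMeasure μ] (hν : Adapted μ ν p A) (hp : 0 ≤ p)
    {C : ℝ≥0} (hC : BalancedWith μ C) (t : ℕ) : ∃ K : ℝ≥0, ∀ S J : DyadicInterval,
    μ S.toSet ≤ μ S.sibling.toSet → ancestor t J = S.sibling →
    μ S.sibling.toSet ≤ 2 ^ t * μ J.toSet ∨
      (ν J.toSet ≤ K * ν S.toSet ∧ ν S.toSet ≤ K * ν J.toSet) := by
  set E : ℝ≥0 := A * (2 * C ^ (0 + 1)) ^ p
  induction t with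
  | zero =>
    refine ⟨0, fun S J _ hJ => Or.inl ?_⟩
    rw [← hJ]
    simp
  | succ t ih =>
    obtain ⟨K, hK⟩ := ih
    set B : ℝ≥0 := A * (2 * C ^ (t + 1)) ^ p
    refine ⟨E + E * B + K * E + E * K, fun S J hS hJ => ?_⟩
    set H := ancestor t J with hHdef
    have hHS : H.parent = S.sibling := (ancestor_succ t J).symm.trans hJ
    rcases le_total (μ H.toSet) (μ H.sibling.toSet) with hH | hH
    · right
      obtain ⟨h1, h2⟩ := hν.comparable_light hp hC hHS hS hH
      constructor
      · refine le_const_mul_of_le (k := E) ((measure_ancestor_mono ν t J).trans h2) ?_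
        rw [add_assoc, add_assoc]
        exact le_self_add
      · refine le_const_mul_of_le (k := E * B) ?_ ?_
        · rw [ENNReal.coe_mul, mul_assoc]
          exact h1.trans (by gcongr; exact hν.light_le_descendant hp hC rfl hH)
        · exact le_add_right (le_add_right le_add_self)
    · have hH' : μ H.sibling.toSet ≤ μ H.sibling.sibling.toSet := by rwa [sibling_sibling]
      rcases hK H.sibling J hH' (by rw [sibling_sibling]) with h | ⟨h3, h4⟩
      · left
        rw [sibling_sibling] at h
        calc μ S.sibling.toSet = μ H.parent.toSet := by rw [hHS]
          _ ≤ μ H.toSet + μ H.sibling.toSet := measure_parent_le μ H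
          _ ≤ μ H.toSet + μ H.toSet := by gcongr
          _ = 2 * μ H.toSet := (two_mul _).symm
          _ ≤ 2 * (2 ^ t * μ J.toSet) := by gcongr
          _ = _ := by ring
      · right
        obtain ⟨h1, h2⟩ := hν.comparable_light hp hC (by rwa [parent_sibling]) hS hH'
        constructor
        · refine le_const_mul_of_le (k := K * E) ?_ ?_
          · rw [ENNReal.coe_mul, mul_assoc]
            exact h3.trans (by gcongr)
          · rw [add_right_comm]
            exact le_add_self
        · refine le_const_mul_of_le (k := E * K) ?_ le_add_self
          rw [ENNReal.coe_mul, mul_assoc]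
          exact h1.trans (by gcongr)

/-- The alternative of `exists_comparable_light` for a descendant `I` of `S` in place of `S`. -/
theorem exists_comparable_sibling [IsLocallyFiniteMeasure μ] (hν : Adapted μ ν p A) (hp : 0 ≤ p)
    {C : ℝ≥0} (hC : BalancedWith μ C) (s t : ℕ) : ∃ K : ℝ≥0, ∀ S I J : DyadicInterval,
    μ S.toSet ≤ μ S.sibling.toSet → ancestor s I = S → ancestor t J = S.sibling →
    μ S.parent.toSet ≤ K * μ J.toSet ∨
      (ν J.toSet ≤ K * ν I.toSet ∧ ν I.toSet ≤ K * ν J.toSet) := by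
  obtain ⟨K, hK⟩ := hν.exists_comparable_light hp hC t
  set B : ℝ≥0 := A * (2 * C ^ (s + 1)) ^ p
  refine ⟨2 ^ (t + 1) + K * B + K, fun S I J hS hI hJ => ?_⟩
  rcases hK S J hS hJ with h | ⟨h1, h2⟩
  · left
    refine le_const_mul_of_le (k := 2 ^ (t + 1)) ?_ (by rw [add_assoc]; exact le_self_add)
    calc μ S.parent.toSet ≤ μ S.toSet + μ S.sibling.toSet := measure_parent_le μ S
      _ ≤ μ S.sibling.toSet + μ S.sibling.toSet := by gcongr
      _ = 2 * μ S.sibling.toSet := (two_mul _).symm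
      _ ≤ 2 * (2 ^ t * μ J.toSet) := by gcongr
      _ = _ := by
          push_cast
          ring
  · right
    constructor
    · refine le_const_mul_of_le (k := K * B) ?_ (by rw [add_right_comm]; exact le_add_self)
      rw [ENNReal.coe_mul, mul_assoc]
      exact h1.trans (by gcongr; exact hν.light_le_descendant hp hC hI hS)
    · exact le_const_mul_of_le ((hI ▸ measure_ancestor_mono ν s I).trans h2) le_add_self

/-- Two intervals with a common ancestor either have a common ancestor that is not much larger than
one of them, or have comparable `ν`-measures. -/
theorem exists_dichotomy [IsLocallyFiniteMeasure μ] (hν : Adapted μ ν p A) (hp : 0 ≤ p)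
    {C : ℝ≥0} (hC : BalancedWith μ C) (s t : ℕ) : ∃ K : ℝ≥0, ∀ I J : DyadicInterval,
    ancestor s I = ancestor t J →
    (∃ a b, ancestor a I = ancestor b J ∧ (μ (ancestor a I).toSet ≤ K * μ I.toSet ∨
      μ (ancestor a I).toSet ≤ K * μ J.toSet)) ∨
      (ν J.toSet ≤ K * ν I.toSet ∧ ν I.toSet ≤ K * ν J.toSet) := by
  induction s generalizing t with
  | zero => exact ⟨1, fun I J h => Or.inl ⟨0, t, h, Or.inl (by simp)⟩⟩
  | succ s ih =>
    cases t with
    | zero => exact ⟨1, fun I J h => Or.inl ⟨s + 1, 0, h, Or.inr (by simp [h])⟩⟩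
    | succ t =>
      obtain ⟨K₀, h₀⟩ := ih t
      obtain ⟨K₁, h₁⟩ := hν.exists_comparable_sibling hp hC s t
      obtain ⟨K₂, h₂⟩ := hν.exists_comparable_sibling hp hC t s
      have le₀ : K₀ ≤ K₀ + K₁ + K₂ := by rw [add_assoc]; exact le_self_add
      have le₁ : K₁ ≤ K₀ + K₁ + K₂ := by rw [add_right_comm]; exact le_add_self
      have le₂ : K₂ ≤ K₀ + K₁ + K₂ := le_add_self
      refine ⟨K₀ + K₁ + K₂, fun I J h => ?_⟩
      have hp' := h
      rw [ancestor_succ, ancestor_succ] at hp'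
      rcases eq_or_eq_sibling hp' with heq | hsib
      · rcases h₀ I J heq with ⟨a, b, hab, h | h⟩ | ⟨h, h'⟩
        · exact Or.inl ⟨a, b, hab, Or.inl (le_const_mul_of_le h le₀)⟩
        · exact Or.inl ⟨a, b, hab, Or.inr (le_const_mul_of_le h le₀)⟩
        · exact Or.inr ⟨le_const_mul_of_le h le₀, le_const_mul_of_le h' le₀⟩
      · have hsib' : ancestor t J = (ancestor s I).sibling := by rw [hsib, sibling_sibling]
        rcases le_total (μ (ancestor s I).toSet) (μ (ancestor t J).toSet) with hle | hle
        · rcases h₁ (ancestor s I) I J (hsib' ▸ hle) rfl hsib' with h' | ⟨h', h''⟩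
          · refine Or.inl ⟨s + 1, t + 1, h, Or.inr ?_⟩
            rw [ancestor_succ]
            exact le_const_mul_of_le h' le₁
          · exact Or.inr ⟨le_const_mul_of_le h' le₁, le_const_mul_of_le h'' le₁⟩
        · rcases h₂ (ancestor t J) J I (hsib ▸ hle) rfl hsib with h' | ⟨h', h''⟩
          · refine Or.inl ⟨s + 1, t + 1, h, Or.inl ?_⟩
            rw [h, ancestor_succ]
            exact le_const_mul_of_le h' le₂
          · exact Or.inr ⟨le_const_mul_of_le h'' le₂, le_const_mul_of_le h' le₂⟩

end Adapted

/-! ### Domination of the modified maximal operator -/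

theorem cb_one_of_ne {I J : DyadicInterval} (h : I ≠ J) :
    cb μ 1 I J = m μ I ^ (1 / 2 : ℝ) * m μ J ^ (1 / 2 : ℝ) / μ J.toSet := by
  rw [cb, if_neg h, sub_self, ENNReal.rpow_zero, mul_one]

/-- The pairs of intervals near each other in which the second has at most `c` times the `ν`-measure
of the first. -/
def NearPair (ν : Measure ℝ) (n : ℕ) (c : ℝ≥0) (I J : DyadicInterval) : Prop :=
  J ∈ nearby n I ∧ ν J.toSet ≤ c * ν I.toSet

theorem controlled_nearPair (ν : Measure ℝ) (n : ℕ) (c : ℝ≥0) :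
    Controlled ν n c (NearPair ν n c) :=
  ⟨fun h => h.1, fun h => h.2⟩

theorem nearPair_self (n : ℕ) {c : ℝ≥0} (hc : 1 ≤ c) (I : DyadicInterval) :
    NearPair ν n c I I :=
  ⟨mem_nearby_self n I, le_mul_of_one_le_left' (by exact_mod_cast hc)⟩

theorem cb_one_le {C : ℝ≥0} (hC : BalancedWith μ C) {I J : DyadicInterval} {s t : ℕ}
    (h : ancestor s I = ancestor t J) : cb μ 1 I J ≤ C ^ (s + t) := by
  by_cases hIJ : I = J
  · rw [cb, if_pos hIJ]
    exact one_le_pow₀ (by exact_mod_cast hC.1)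
  · rw [cb_one_of_ne hIJ]
    refine ENNReal.div_le_of_le_mul ((hC.sqrt_m_mul_sqrt_m_le h).trans ?_)
    gcongr
    exact m_le_measure J

theorem div_le_const_mul_div {a b x y : ℝ≥0∞} {D : ℝ≥0} (hD : D ≠ 0) (hab : a ≤ b)
    (hy : y ≤ D * x) : a / x ≤ D * (b / y) := by
  have hD' : (D : ℝ≥0∞) ≠ 0 := by exact_mod_cast hD
  calc a / x ≤ b / x := by gcongr
    _ = D * (b / (D * x)) := by
        rw [div_eq_mul_inv, div_eq_mul_inv,
          ENNReal.mul_inv (Or.inl hD') (Or.inl ENNReal.coe_ne_top), mul_left_comm b, ← mul_assoc,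
          ENNReal.mul_inv_cancel hD' ENNReal.coe_ne_top, one_mul]
    _ ≤ _ := by gcongr

/-- If a common ancestor `L` is not much larger than `I` or than `J`, then the term of the modified
maximal operator for `(I, J)` is dominated by the average over `L`. -/
theorem cb_one_mul_average_le {C D : ℝ≥0} (hC : BalancedWith μ C) (hD0 : D ≠ 0)
    {I J : DyadicInterval} {s t a b : ℕ} (h : ancestor s I = ancestor t J)
    (hab : ancestor a I = ancestor b J)
    (hD : μ (ancestor a I).toSet ≤ D * μ I.toSet ∨ μ (ancestor a I).toSet ≤ D * μ J.toSet)
    (f : ℝ → ℝ≥0∞) :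
    cb μ 1 I J * average μ f I ≤ (C ^ (s + t) * D : ℝ≥0) * average μ f (ancestor a I) := by
  have hI := toSet_subset_ancestor a I
  rcases hD with hD | hD
  · rw [ENNReal.coe_mul, mul_assoc]
    refine mul_le_mul' ?_ (div_le_const_mul_div hD0 (lintegral_mono_set hI) hD)
    exact_mod_cast cb_one_le hC h
  · by_cases hIJ : I = J
    · subst hIJ
      rw [ENNReal.coe_mul, mul_assoc]
      refine mul_le_mul' ?_ (div_le_const_mul_div hD0 (lintegral_mono_set hI) hD)
      exact_mod_cast cb_one_le hC h
    -- The factor `m I / μ I ≤ 1` turns the average over `I` into an integral divided by `μ J`.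
    have hq : m μ I ^ (1 / 2 : ℝ) * m μ J ^ (1 / 2 : ℝ) ≤ C ^ (s + t) * μ I.toSet := by
      rw [mul_comm (m μ I ^ _), add_comm s]
      refine (hC.sqrt_m_mul_sqrt_m_le h.symm).trans ?_
      gcongr
      exact m_le_measure I
    calc cb μ 1 I J * average μ f I
        ≤ C ^ (s + t) * μ I.toSet / μ J.toSet * ((∫⁻ x in I.toSet, f x ∂μ) / μ I.toSet) := by
          rw [cb_one_of_ne hIJ, average]
          gcongr
      _ = C ^ (s + t) * (μ I.toSet * ((∫⁻ x in I.toSet, f x ∂μ) / μ I.toSet)) / μ J.toSet := by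
          simp only [div_eq_mul_inv]
          ring
      _ ≤ C ^ (s + t) * (∫⁻ x in (ancestor a I).toSet, f x ∂μ) / μ J.toSet := by
          gcongr
          exact ENNReal.mul_div_le.trans (lintegral_mono_set hI)
      _ = C ^ (s + t) * ((∫⁻ x in (ancestor a I).toSet, f x ∂μ) / μ J.toSet) := mul_div_assoc _ _ _
      _ ≤ C ^ (s + t) * (D * average μ f (ancestor a I)) := by
          gcongr
          exact div_le_const_mul_div hD0 le_rfl hD
      _ = _ := by
          push_cast
          ring

/-- The modified maximal operator is dominated by a maximal function over pairs of intervals that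
are controlled by a given adapted measure `ν`. -/
theorem exists_maximal_le [IsLocallyFiniteMeasure μ] {p : ℝ} {A : ℝ≥0} (hν : Adapted μ ν p A)
    (hp : 0 ≤ p) {C : ℝ≥0} (hC : BalancedWith μ C) (N : ℕ) : ∃ c K : ℝ≥0, ∀ (f : ℝ → ℝ) (x : ℝ),
    maximal μ N f x ≤ K * pairMaximal μ (NearPair ν (N + 2) c) (fun y => ‖f y‖ₑ) x := by
  choose k hk using hν.exists_dichotomy hp hC
  set n := N + 2
  set D : ℝ≥0 := 1 + ∑ s ∈ Finset.range (n + 1), ∑ t ∈ Finset.range (n + 1), k s t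
  have hD1 : 1 ≤ D := le_self_add
  have hkD : ∀ s ≤ n, ∀ t ≤ n, k s t ≤ D := by
    intro s hs t ht
    calc k s t ≤ ∑ t ∈ Finset.range (n + 1), k s t :=
          Finset.single_le_sum (f := k s) (fun _ _ => zero_le) (Finset.mem_range.2 (by lia))
      _ ≤ ∑ s ∈ Finset.range (n + 1), ∑ t ∈ Finset.range (n + 1), k s t :=
          Finset.single_le_sum (f := fun s => ∑ t ∈ Finset.range (n + 1), k s t)
            (fun _ _ => zero_le) (Finset.mem_range.2 (by lia))
      _ ≤ D := le_add_self
  refine ⟨D, C ^ (n + n) * D, fun f x => ?_⟩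
  refine iSup_le fun I => iSup_le fun J => iSup_le fun hIJ => indicator_apply_le' (fun hx => ?_)
    fun _ => zero_le
  obtain ⟨s, hs, t, ht, hst⟩ := exists_ancestor_eq_of_dist_le hIJ
  have hCpow : C ^ (s + t) ≤ C ^ (n + n) := pow_le_pow_right₀ hC.1 (by lia)
  rcases hk s t I J hst with ⟨a, b, hab, h⟩ | ⟨h, -⟩
  · have h' : μ (ancestor a I).toSet ≤ D * μ I.toSet ∨ μ (ancestor a I).toSet ≤ D * μ J.toSet :=
      h.imp (fun h => le_const_mul_of_le h (hkD s hs t ht))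
        fun h => le_const_mul_of_le h (hkD s hs t ht)
    refine (cb_one_mul_average_le hC (by positivity) hst hab h' _).trans ?_
    gcongr
    refine average_le_pairMaximal (nearPair_self n hD1 (ancestor a I)) _ ?_
    exact hab ▸ toSet_subset_ancestor b J hx
  · have hcb : cb μ 1 I J ≤ (C ^ (n + n) * D : ℝ≥0) := by
      refine (cb_one_le hC hst).trans ?_
      exact_mod_cast hCpow.trans (le_mul_of_one_le_right' hD1)
    gcongr
    exact average_le_pairMaximal (P := NearPair ν n D)
      ⟨⟨s, hs, t, ht, hst⟩, le_const_mul_of_le h (hkD s hs t ht)⟩ _ hx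

/-! ### From the characteristics to adapted measures -/

theorem rpow_eq_mul_rpow_sub_one (x : ℝ≥0∞) {p : ℝ} (hp : 1 ≤ p) :
    x ^ p = x * x ^ (p - 1) := by
  conv_rhs => rw [← ENNReal.rpow_one x, ← ENNReal.rpow_mul, one_mul]
  rw [← ENNReal.rpow_add_of_nonneg _ _ zero_le_one (by linarith)]
  ring_nf

theorem mul_div_mul_div_rpow {p : ℝ} (hp : 1 ≤ p) {a b : ℝ≥0∞} (ha : a ≠ 0) (ha' : a ≠ ∞)
    (hb : b ≠ 0) (hb' : b ≠ ∞) (q V M : ℝ≥0∞) :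
    q / (b * a ^ (p - 1)) * (V / a) * (M / b ^ (p - 1)) = q * (V * M) / (a ^ p * b ^ p) := by
  have hp1 : 0 ≤ p - 1 := by linarith
  have pow0 : ∀ {x : ℝ≥0∞} {r : ℝ}, x ≠ 0 → x ≠ ∞ → x ^ r ≠ 0 := fun h h' => by
    simp [ENNReal.rpow_eq_zero_iff, h, h']
  have powt : ∀ {x : ℝ≥0∞} {r : ℝ}, 0 ≤ r → x ≠ ∞ → x ^ r ≠ ∞ := fun h h' =>
    ENNReal.rpow_ne_top_of_nonneg h h'
  rw [rpow_eq_mul_rpow_sub_one a hp, rpow_eq_mul_rpow_sub_one b hp]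
  simp only [div_eq_mul_inv]
  rw [ENNReal.mul_inv (Or.inl hb) (Or.inl hb'),
    ENNReal.mul_inv (Or.inl (mul_ne_zero ha (pow0 ha ha')))
      (Or.inl (ENNReal.mul_ne_top ha' (powt hp1 ha'))),
    ENNReal.mul_inv (Or.inl ha) (Or.inl ha'), ENNReal.mul_inv (Or.inl hb) (Or.inl hb')]
  ring

/-- The term of a balanced characteristic for the pair `(I, J)`, in terms of the coefficient of the
modified maximal operator for the pair `(J, I)`. -/
theorem cb_mul_eq [IsLocallyFiniteMeasure μ] {p : ℝ} (hp : 1 ≤ p) {I J : DyadicInterval}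
    (hI : μ I.toSet ≠ 0) (hJ : μ J.toSet ≠ 0) (V M : ℝ≥0∞) :
    cb μ p I J * (V / μ I.toSet) * (M / μ J.toSet ^ (p - 1)) =
      cb μ 1 J I ^ p * (V * M) / μ J.toSet ^ p := by
  have hp0 : 0 ≤ p := by linarith
  have hIt := measure_toSet_ne_top (μ := μ) I
  have hJt := measure_toSet_ne_top (μ := μ) J
  by_cases hIJ : I = J
  · subst hIJ
    have h0 : μ I.toSet ^ (p - 1) ≠ 0 := by simp [ENNReal.rpow_eq_zero_iff, hI, hIt]
    rw [cb, if_pos rfl, cb, if_pos rfl, ENNReal.one_rpow, rpow_eq_mul_rpow_sub_one _ hp,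
      one_mul, one_mul]
    simp only [div_eq_mul_inv]
    rw [ENNReal.mul_inv (Or.inl hI) (Or.inl hIt)]
    ring
  · have hpow : ∀ K, (m μ K ^ (1 / 2 : ℝ)) ^ p = m μ K ^ (p / 2) := fun K => by
      rw [← ENNReal.rpow_mul]
      ring_nf
    have hI0 : μ I.toSet ^ p ≠ 0 := by simp [ENNReal.rpow_eq_zero_iff, hI, hIt]
    rw [cb, if_neg hIJ, mul_div_mul_div_rpow hp hI hIt hJ hJt, cb_one_of_ne (Ne.symm hIJ),
      ENNReal.div_rpow_of_nonneg _ _ hp0, ENNReal.mul_rpow_of_nonneg _ _ hp0, hpow, hpow]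
    simp only [div_eq_mul_inv]
    rw [ENNReal.mul_inv (Or.inl hI0) (Or.inl (ENNReal.rpow_ne_top_of_nonneg hp0 hIt))]
    ring

theorem mul_le_of_diagonal_le [IsLocallyFiniteMeasure μ] {p : ℝ} (hp : 1 ≤ p) {I : DyadicInterval}
    {V M A : ℝ≥0∞} (hV : μ I.toSet = 0 → V = 0)
    (h : cb μ p I I * (V / μ I.toSet) * (M / μ I.toSet ^ (p - 1)) ≤ A) :
    V * M ≤ A * μ I.toSet ^ p := by
  rcases eq_or_ne (μ I.toSet) 0 with h0 | h0
  · rw [hV h0, zero_mul]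
    exact zero_le
  have ht := measure_toSet_ne_top (μ := μ) I
  rw [cb_mul_eq hp h0 h0, cb, if_pos rfl, ENNReal.one_rpow, one_mul] at h
  refine (ENNReal.div_le_iff ?_ (ENNReal.rpow_ne_top_of_nonneg (by linarith) ht)).1 h
  simp [ENNReal.rpow_eq_zero_iff, h0, ht]

/-- A characteristic bound with a dual quantity `M` makes `ν` adapted to `μ`. For `A_p^b` the dual
quantity of `J` is the `(p - 1)`-st power of the dual weight of `J`, for `A_1^b` it is the essential
supremum of `w⁻¹` on `J`. -/
theorem adapted_of_characteristic_le [IsLocallyFiniteMeasure μ] {p : ℝ} (hp : 1 ≤ p) {C : ℝ≥0}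
    (hC : BalancedWith μ C) (ac : ν ≪ μ) {M : DyadicInterval → ℝ≥0∞}
    (holder : ∀ I, μ I.toSet ^ p ≤ ν I.toSet * M I)
    (mono : ∀ a I, M I ≤ M (ancestor a I)) {A : ℝ≥0}
    (hA : ∀ I J, Adjacent I J →
      cb μ p I J * (ν I.toSet / μ I.toSet) * (M J / μ J.toSet ^ (p - 1)) ≤ A) :
    Adapted μ ν p (A * (C ^ 3) ^ (p / 2)) := by
  have hp0 : 0 < p := by linarith
  have hC3 : (1 : ℝ≥0) ≤ (C ^ 3) ^ (p / 2) :=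
    NNReal.one_le_rpow (one_le_pow₀ hC.1) (by linarith)
  refine ⟨ac, fun a I => ?_, fun {I J} hne hIJ => ?_⟩
  · set L := ancestor a I
    have hL : ν L.toSet * M L ≤ A * μ L.toSet ^ p :=
      mul_le_of_diagonal_le hp (fun h => ac h) (hA L L (adjacent_self L))
    calc μ I.toSet ^ p * ν L.toSet ≤ ν I.toSet * M I * ν L.toSet := by gcongr; exact holder I
      _ ≤ ν I.toSet * M L * ν L.toSet := by gcongr; exact mono a I
      _ = ν I.toSet * (ν L.toSet * M L) := by ring
      _ ≤ ν I.toSet * (A * μ L.toSet ^ p) := by gcongr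
      _ = A * μ L.toSet ^ p * ν I.toSet := by ring
      _ ≤ _ := by
        gcongr
        exact le_mul_of_one_le_right' hC3
  · obtain ⟨s, t, hst, h⟩ := hIJ.exists_ancestor_eq hne
    have hm : m μ I ≤ C ^ 3 * m μ J := hst ▸ hC.m_le_of_ancestor_eq h
    rcases eq_or_ne (m μ I) 0 with h0 | h0
    · rw [h0, ENNReal.zero_rpow_of_pos hp0, zero_mul]
      exact zero_le
    have hI0 : μ I.toSet ≠ 0 := fun h' => h0 (le_antisymm (h' ▸ m_le_measure I) zero_le)
    have hJ0 : μ J.toSet ≠ 0 := by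
      intro h'
      have : m μ J = 0 := le_antisymm (h' ▸ m_le_measure J) zero_le
      rw [this, mul_zero] at hm
      exact h0 (le_antisymm hm zero_le)
    have hIt := measure_toSet_ne_top (μ := μ) I
    have hJt := measure_toSet_ne_top (μ := μ) J
    have pow0 : ∀ {x : ℝ≥0∞} {r : ℝ}, x ≠ 0 → x ≠ ∞ → x ^ r ≠ 0 := fun h h' => by
      simp [ENNReal.rpow_eq_zero_iff, h, h']
    have powt : ∀ {x : ℝ≥0∞}, x ≠ ∞ → x ^ p ≠ ∞ := fun h' =>
      ENNReal.rpow_ne_top_of_nonneg hp0.le h'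
    have key := hA I J hIJ
    rw [cb, if_neg hne, mul_div_mul_div_rpow hp hI0 hIt hJ0 hJt, ENNReal.div_le_iff
      (mul_ne_zero (pow0 hI0 hIt) (pow0 hJ0 hJt)) (ENNReal.mul_ne_top (powt hIt) (powt hJt))] at key
    refine (ENNReal.mul_le_mul_iff_right (pow0 (r := p) hJ0 hJt) (powt hJt)).1 ?_
    have hmm : m μ I ^ p ≤ ((C ^ 3) ^ (p / 2) : ℝ≥0) * (m μ I ^ (p / 2) * m μ J ^ (p / 2)) := by
      calc m μ I ^ p = m μ I ^ (p / 2) * m μ I ^ (p / 2) := by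
            rw [← ENNReal.rpow_add_of_nonneg _ _ (by linarith) (by linarith), add_halves]
        _ ≤ m μ I ^ (p / 2) * (C ^ 3 * m μ J) ^ (p / 2) := by gcongr
        _ = _ := by
            rw [ENNReal.mul_rpow_of_nonneg _ _ (by linarith), ENNReal.coe_rpow_of_nonneg _
              (by linarith : 0 ≤ p / 2), ENNReal.coe_pow]
            ring
    calc μ J.toSet ^ p * (m μ I ^ p * ν I.toSet)
        ≤ ν J.toSet * M J * (((C ^ 3) ^ (p / 2) : ℝ≥0) * (m μ I ^ (p / 2) * m μ J ^ (p / 2)) *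
            ν I.toSet) := by
          gcongr
          exact holder J
      _ = ((C ^ 3) ^ (p / 2) : ℝ≥0) * ν J.toSet *
            (m μ I ^ (p / 2) * m μ J ^ (p / 2) * (ν I.toSet * M J)) := by ring
      _ ≤ ((C ^ 3) ^ (p / 2) : ℝ≥0) * ν J.toSet * (A * (μ I.toSet ^ p * μ J.toSet ^ p)) := by
          gcongr
      _ = _ := by
          push_cast
          ring

/-! ### Weights -/

namespace IsWeight

variable {w : ℝ → ℝ} (hw : IsWeight μ w)
include hw

theorem aemeasurable : AEMeasurable w μ :=
  hw.locallyIntegrable.aestronglyMeasurable.aemeasurable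

theorem aemeasurable_ofReal : AEMeasurable (fun x => ENNReal.ofReal (w x)) μ :=
  hw.aemeasurable.ennreal_ofReal

theorem ofReal_ne_zero : ∀ᵐ x ∂μ, ENNReal.ofReal (w x) ≠ 0 :=
  hw.pos.mono fun x hx => by simpa using hx

theorem weighted_ne_top (I : DyadicInterval) : weighted μ w I.toSet ≠ ∞ := by
  rw [weighted, withDensity_apply _ I.measurableSet_toSet]
  have h := (hw.locallyIntegrable.integrableOn_isCompact
    (isCompact_Icc (a := (2 : ℝ) ^ (-I.k) * I.j) (b := (2 : ℝ) ^ (-I.k) * (I.j + 1)))).mono_set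
    Ico_subset_Icc_self
  exact ((lintegral_mono fun x => Real.ofReal_le_enorm (w x)).trans_lt h.2).ne

theorem absolutelyContinuous_weighted : μ ≪ weighted μ w :=
  withDensity_absolutelyContinuous' hw.aemeasurable_ofReal hw.ofReal_ne_zero

end IsWeight

theorem weighted_absolutelyContinuous (w : ℝ → ℝ) : weighted μ w ≪ μ :=
  withDensity_absolutelyContinuous _ _

theorem weighted_apply (w : ℝ → ℝ) (I : DyadicInterval) :
    weighted μ w I.toSet = ∫⁻ x in I.toSet, ENNReal.ofReal (w x) ∂μ :=
  withDensity_apply _ I.measurableSet_toSet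

instance [SFinite μ] (w : ℝ → ℝ) : SFinite (weighted μ w) := by
  unfold weighted
  infer_instance

theorem setLIntegral_weighted {w : ℝ → ℝ} (hw : AEMeasurable w μ) {F : ℝ → ℝ≥0∞}
    (hF : AEMeasurable F μ) (I : DyadicInterval) :
    ∫⁻ x in I.toSet, F x ∂weighted μ w = ∫⁻ x in I.toSet, F x * ENNReal.ofReal (w x) ∂μ := by
  rw [weighted, setLIntegral_withDensity_eq_lintegral_mul₀ hw.ennreal_ofReal hF
    I.measurableSet_toSet]
  simp only [Pi.mul_apply, mul_comm]

theorem lintegral_weighted {w : ℝ → ℝ} (hw : AEMeasurable w μ) {F : ℝ → ℝ≥0∞}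
    (hF : AEMeasurable F μ) :
    ∫⁻ x, F x ∂weighted μ w = ∫⁻ x, F x * ENNReal.ofReal (w x) ∂μ := by
  rw [weighted, lintegral_withDensity_eq_lintegral_mul₀ hw.ennreal_ofReal hF]
  simp only [Pi.mul_apply, mul_comm]

/-- A pointwise bound for averages, after raising to a power, passes to maximal functions. -/
theorem rpow_pairMaximal_le {P : DyadicInterval → DyadicInterval → Prop} {F h : ℝ → ℝ≥0∞} {r : ℝ}
    (hr : 0 < r) {A : ℝ≥0∞} (H : ∀ I, average μ F I ^ r ≤ A * average ν h I) (x : ℝ) :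
    pairMaximal μ P F x ^ r ≤ A * pairMaximal ν P h x := by
  rw [← ENNReal.le_rpow_inv_iff hr]
  refine pairMaximal_le fun I J hIJ hx => ?_
  rw [ENNReal.le_rpow_inv_iff hr]
  exact (H I).trans (by gcongr; exact average_le_pairMaximal hIJ h hx)

/-! ### Sufficiency for `1 < p` -/

/-- The dual weight `w^(1 - p')`. -/
def dualWeight (p : ℝ) (w : ℝ → ℝ) (x : ℝ) : ℝ := w x ^ (1 - p.conjExponent)

theorem one_sub_conjExponent {p : ℝ} (hp : 1 < p) : 1 - p.conjExponent = -(p - 1)⁻¹ := by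
  have : p - 1 ≠ 0 := by linarith
  rw [Real.conjExponent]
  field_simp
  ring

theorem average_dualWeight_rpow {p : ℝ} (hp : 1 < p) (w : ℝ → ℝ) (J : DyadicInterval) :
    average μ (fun x => ENNReal.ofReal (w x ^ (1 - p.conjExponent))) J ^ (p - 1) =
      weighted μ (dualWeight p w) J.toSet ^ (p - 1) / μ J.toSet ^ (p - 1) := by
  rw [average, ENNReal.div_rpow_of_nonneg _ _ (by linarith), weighted_apply]
  rfl

namespace IsWeight

variable {w : ℝ → ℝ} (hw : IsWeight μ w) {p : ℝ} (hp : 1 < p)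
include hw

theorem aemeasurable_dualWeight (p : ℝ) : AEMeasurable (dualWeight p w) μ :=
  hw.aemeasurable.pow_const _

theorem dualWeight_pos (p : ℝ) : ∀ᵐ x ∂μ, 0 < dualWeight p w x :=
  hw.pos.mono fun _ hx => Real.rpow_pos_of_pos hx _

include hp

theorem dualWeight_rpow_mul : ∀ᵐ x ∂μ,
    ENNReal.ofReal (dualWeight p w x) ^ (p - 1) * ENNReal.ofReal (w x) = 1 := by
  filter_upwards [hw.pos] with x hx
  have hp1 : p - 1 ≠ 0 := by linarith
  rw [dualWeight, ENNReal.ofReal_rpow_of_nonneg (Real.rpow_nonneg hx.le _) (by linarith),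
    ← Real.rpow_mul hx.le, one_sub_conjExponent hp, neg_mul, inv_mul_cancel₀ hp1,
    ← ENNReal.ofReal_mul (Real.rpow_nonneg hx.le _), Real.rpow_neg_one, inv_mul_cancel₀ hx.ne',
    ENNReal.ofReal_one]

/-- Hölder's inequality for the weight and its dual. -/
theorem measure_rpow_le_mul_dualWeight (I : DyadicInterval) :
    μ I.toSet ^ p ≤
      weighted μ w I.toSet * weighted μ (dualWeight p w) I.toSet ^ (p - 1) := by
  have hp0 : 0 < p := by linarith
  have hq := Real.HolderConjugate.conjExponent hp
  have hp1 : p - 1 ≠ 0 := by linarith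
  set q := p.conjExponent
  have hq0 : 0 < q := hq.symm.pos
  have hone : ∀ᵐ x ∂μ.restrict I.toSet, 1 = ((fun x => ENNReal.ofReal (w x) ^ (1 / p)) *
      fun x => ENNReal.ofReal (dualWeight p w x) ^ (1 / q)) x := by
    refine ae_restrict_of_ae ?_
    filter_upwards [hw.dualWeight_rpow_mul hp] with x hx
    have hpq : (p - 1) * (1 / p) = 1 / q := by
      simp only [q, Real.conjExponent]
      field_simp
    rw [Pi.mul_apply, ← hpq, ENNReal.rpow_mul, ← ENNReal.mul_rpow_of_nonneg _ _ (by positivity),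
      mul_comm, hx, ENNReal.one_rpow]
  have hle := ENNReal.lintegral_mul_le_Lp_mul_Lq (μ.restrict I.toSet) hq
    (hw.aemeasurable_ofReal.restrict.pow_const (1 / p))
    ((hw.aemeasurable_dualWeight p).ennreal_ofReal.restrict.pow_const (1 / q))
  rw [← lintegral_congr_ae hone, setLIntegral_one] at hle
  simp only [← ENNReal.rpow_mul, one_div, inv_mul_cancel₀ hp0.ne', inv_mul_cancel₀ hq0.ne',
    ENNReal.rpow_one] at hle
  calc μ I.toSet ^ p ≤ _ := ENNReal.rpow_le_rpow hle hp0.le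
    _ = _ := by
      have hpq : q⁻¹ * p = p - 1 := by
        simp only [q, Real.conjExponent]
        field_simp
      rw [ENNReal.mul_rpow_of_nonneg _ _ hp0.le, ← ENNReal.rpow_mul, ← ENNReal.rpow_mul,
        inv_mul_cancel₀ hp0.ne', ENNReal.rpow_one, hpq, weighted_apply, weighted_apply]

end IsWeight

theorem apbChar_term_le {p : ℝ} (hp : 1 < p) {w : ℝ → ℝ} {A : ℝ≥0} (hA : apbChar μ p w ≤ A)
    {I J : DyadicInterval} (h : Adjacent I J) :
    cb μ p I J * (weighted μ w I.toSet / μ I.toSet) *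
      (weighted μ (dualWeight p w) J.toSet ^ (p - 1) / μ J.toSet ^ (p - 1)) ≤ A := by
  refine le_trans ?_ hA
  rw [← average_dualWeight_rpow hp, weighted_apply]
  exact le_iSup_of_le I <| le_iSup_of_le J <| le_iSup_of_le h le_rfl

theorem IsWeight.adapted_of_apbChar_le [IsLocallyFiniteMeasure μ] {w : ℝ → ℝ} (hw : IsWeight μ w)
    {p : ℝ} (hp : 1 < p) {C : ℝ≥0} (hC : BalancedWith μ C) {A : ℝ≥0} (hA : apbChar μ p w ≤ A) :
    Adapted μ (weighted μ w) p (A * (C ^ 3) ^ (p / 2)) :=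
  adapted_of_characteristic_le hp.le hC (weighted_absolutelyContinuous w)
    (M := fun I => weighted μ (dualWeight p w) I.toSet ^ (p - 1))
    (hw.measure_rpow_le_mul_dualWeight hp)
    (fun a I => ENNReal.rpow_le_rpow (measure_ancestor_mono _ a I) (by linarith))
    fun _ _ h => apbChar_term_le hp hA h

/-- The dyadic maximal function with respect to the dual weight, applied to `F` divided by the dual
weight. -/
def dualMaximal (μ : Measure ℝ) (p : ℝ) (w : ℝ → ℝ) (F : ℝ → ℝ≥0∞) : ℝ → ℝ≥0∞ :=
  pairMaximal (weighted μ (dualWeight p w)) Eq fun x => F x / ENNReal.ofReal (dualWeight p w x)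

/-- The averages of `F` are dominated, after raising to the power `p - 1`, by the averages with
respect to `w` of a function whose `L^{p'}(w)` norm is controlled by that of `F` in `L^p(w)`. -/
theorem IsWeight.average_rpow_le [IsLocallyFiniteMeasure μ] {w : ℝ → ℝ} (hw : IsWeight μ w)
    {p : ℝ} (hp : 1 < p) {A : ℝ≥0} (hA : apbChar μ p w ≤ A) {F : ℝ → ℝ≥0∞}
    (hF : AEMeasurable F μ) (I : DyadicInterval) :
    average μ F I ^ (p - 1) ≤ A * average (weighted μ w)
      (fun x => dualMaximal μ p w F x ^ (p - 1) / ENNReal.ofReal (w x)) I := by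
  have hp1 : 0 < p - 1 := by linarith
  set σ := weighted μ (dualWeight p w)
  set V := weighted μ w I.toSet
  set X := ∫⁻ x in I.toSet, F x ∂μ
  rcases eq_or_ne (μ I.toSet) 0 with h0 | h0
  · rw [average, setLIntegral_measure_zero _ _ h0, ENNReal.zero_div,
      ENNReal.zero_rpow_of_pos hp1]
    exact zero_le
  have ht := measure_toSet_ne_top (μ := μ) I
  have hV0 : V ≠ 0 := fun h => h0 (hw.absolutelyContinuous_weighted h)
  have hVt : V ≠ ∞ := hw.weighted_ne_top I
  have hchar : V * σ I.toSet ^ (p - 1) ≤ A * μ I.toSet ^ p :=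
    mul_le_of_diagonal_le hp.le (fun h => weighted_absolutelyContinuous w h)
      (apbChar_term_le hp hA (adjacent_self I))
  have hσac : μ ≪ σ := withDensity_absolutelyContinuous'
    (hw.aemeasurable_dualWeight p).ennreal_ofReal
    ((hw.dualWeight_pos p).mono fun x hx => by simpa using hx)
  have hσ0 : σ I.toSet ≠ 0 := fun h => h0 (hσac h)
  have hσt : σ I.toSet ≠ ∞ := by
    intro h
    rw [h, ENNReal.top_rpow_of_pos hp1, ENNReal.mul_top hV0] at hchar
    exact ENNReal.mul_ne_top ENNReal.coe_ne_top
      (ENNReal.rpow_ne_top_of_nonneg (by linarith) ht) (top_le_iff.1 hchar)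
  have hX : ∫⁻ x in I.toSet, F x / ENNReal.ofReal (dualWeight p w x) ∂σ = X := by
    have hg : AEMeasurable (fun x => F x / ENNReal.ofReal (dualWeight p w x)) μ :=
      hF.div (hw.aemeasurable_dualWeight p).ennreal_ofReal
    rw [setLIntegral_weighted (hw.aemeasurable_dualWeight p) hg]
    refine lintegral_congr_ae (ae_restrict_of_ae ?_)
    filter_upwards [hw.dualWeight_pos p] with x hx
    exact ENNReal.div_mul_cancel (by simpa using hx) ENNReal.ofReal_ne_top
  have hint : μ I.toSet * (X / σ I.toSet) ^ (p - 1) ≤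
      ∫⁻ x in I.toSet, dualMaximal μ p w F x ^ (p - 1) / ENNReal.ofReal (w x) ∂weighted μ w := by
    have hh : AEMeasurable
        (fun x => dualMaximal μ p w F x ^ (p - 1) / ENNReal.ofReal (w x)) μ :=
      ((measurable_pairMaximal _).pow_const _).aemeasurable.div hw.aemeasurable_ofReal
    rw [setLIntegral_weighted hw.aemeasurable hh, mul_comm, ← setLIntegral_const]
    refine lintegral_mono_ae ?_
    filter_upwards [ae_restrict_mem I.measurableSet_toSet,
      ae_restrict_of_ae hw.ofReal_ne_zero] with x hxI hx
    rw [ENNReal.div_mul_cancel hx ENNReal.ofReal_ne_top]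
    gcongr
    rw [← hX]
    exact average_le_pairMaximal (P := Eq) rfl _ hxI
  rw [average, average, ← mul_div_assoc, ENNReal.le_div_iff_mul_le (Or.inl hV0) (Or.inl hVt)]
  refine le_trans ?_ (mul_le_mul_right hint _)
  have hσX : X = X / σ I.toSet * σ I.toSet := (ENNReal.div_mul_cancel hσ0 hσt).symm
  have hμp0 : μ I.toSet ^ (p - 1) ≠ 0 := by simp [ENNReal.rpow_eq_zero_iff, h0, ht]
  have hμpt : μ I.toSet ^ (p - 1) ≠ ∞ := ENNReal.rpow_ne_top_of_nonneg hp1.le ht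
  calc (X / μ I.toSet) ^ (p - 1) * V
      = (X / σ I.toSet) ^ (p - 1) * (V * σ I.toSet ^ (p - 1)) / μ I.toSet ^ (p - 1) := by
        rw [ENNReal.div_rpow_of_nonneg _ _ hp1.le]
        conv_lhs => rw [hσX, ENNReal.mul_rpow_of_nonneg _ _ hp1.le]
        simp only [div_eq_mul_inv]
        ring
    _ ≤ (X / σ I.toSet) ^ (p - 1) * (A * μ I.toSet ^ p) / μ I.toSet ^ (p - 1) := by gcongr
    _ = A * (μ I.toSet * (X / σ I.toSet) ^ (p - 1)) *
          (μ I.toSet ^ (p - 1) / μ I.toSet ^ (p - 1)) := by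
        rw [rpow_eq_mul_rpow_sub_one _ hp.le]
        simp only [div_eq_mul_inv]
        ring
    _ = _ := by rw [ENNReal.div_self hμp0 hμpt, mul_one]

/-- The `L^{p'}(w)` norm of the function that dominates the averages of `F`. -/
theorem IsWeight.exists_lintegral_dualMaximal_le [IsLocallyFiniteMeasure μ] {p : ℝ} (hp : 1 < p) :
    ∃ K : ℝ≥0, ∀ (w : ℝ → ℝ), IsWeight μ w → ∀ F : ℝ → ℝ≥0∞, AEMeasurable F μ →
    ∫⁻ x, (dualMaximal μ p w F x ^ (p - 1) / ENNReal.ofReal (w x)) ^ p.conjExponent ∂weighted μ w ≤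
      K * ∫⁻ x, F x ^ p ∂weighted μ w := by
  obtain ⟨K, hK⟩ := exists_strongType_pairMaximal 0 1 hp
  refine ⟨K, fun w hw F hF => ?_⟩
  have hp0 : 0 ≤ p := by linarith
  have hp1 : p - 1 ≠ 0 := by linarith
  have hq := Real.HolderConjugate.conjExponent hp
  have hM : AEMeasurable (dualMaximal μ p w F) μ := (measurable_pairMaximal _).aemeasurable
  have hg : AEMeasurable (fun x => F x / ENNReal.ofReal (dualWeight p w x)) μ :=
    hF.div (hw.aemeasurable_dualWeight p).ennreal_ofReal
  have hh : AEMeasurable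
      (fun x => (dualMaximal μ p w F x ^ (p - 1) / ENNReal.ofReal (w x)) ^ p.conjExponent) μ :=
    ((hM.pow_const _).div hw.aemeasurable_ofReal).pow_const _
  have key := hK (weighted μ (dualWeight p w)) Eq (controlled_eq _) _
    (hg.mono_ac (weighted_absolutelyContinuous _))
  rw [lintegral_weighted (hw.aemeasurable_dualWeight p) (hg.pow_const p)] at key
  have key' := lintegral_weighted (hw.aemeasurable_dualWeight p) (hM.pow_const p)
  rw [dualMaximal] at key'
  rw [key'] at key
  rw [lintegral_weighted hw.aemeasurable hh, lintegral_weighted hw.aemeasurable (hF.pow_const p)]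
  refine (lintegral_congr_ae ?_).trans_le (key.trans_eq (congrArg _ (lintegral_congr_ae ?_)))
  · filter_upwards [hw.pos] with x hx
    have hv0 : ENNReal.ofReal (w x) ≠ 0 := by simpa using hx
    have hv : ENNReal.ofReal (w x) ^ p.conjExponent =
        ENNReal.ofReal (w x) * ENNReal.ofReal (dualWeight p w x) ^ (-1 : ℝ) := by
      rw [dualWeight, ← ENNReal.ofReal_rpow_of_pos hx, ← ENNReal.rpow_mul]
      nth_rewrite 2 [← ENNReal.rpow_one (ENNReal.ofReal (w x))]
      rw [← ENNReal.rpow_add _ _ hv0 ENNReal.ofReal_ne_top]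
      ring_nf
    have hpq : (p - 1) * p.conjExponent = p := by
      rw [Real.conjExponent]
      field_simp
    rw [ENNReal.div_rpow_of_nonneg _ _ hq.symm.nonneg, hv, ← ENNReal.rpow_mul, hpq,
      ENNReal.rpow_neg_one, div_eq_mul_inv,
      ENNReal.mul_inv (Or.inl hv0) (Or.inl ENNReal.ofReal_ne_top), inv_inv, mul_assoc,
      mul_right_comm, ENNReal.inv_mul_cancel hv0 ENNReal.ofReal_ne_top, one_mul]
    rfl
  · filter_upwards [hw.dualWeight_rpow_mul hp, hw.dualWeight_pos p] with x hx hpos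
    set s := ENNReal.ofReal (dualWeight p w x) with hsdef
    have hs0 : s ≠ 0 := by simpa [hsdef] using hpos
    have hst : s ≠ ∞ := ENNReal.ofReal_ne_top
    have hv : ENNReal.ofReal (w x) = (s ^ (p - 1))⁻¹ := by
      rw [mul_comm] at hx
      exact ENNReal.eq_inv_of_mul_eq_one_left hx
    rw [ENNReal.div_rpow_of_nonneg _ _ hp0, hv, div_eq_mul_inv,
      rpow_eq_mul_rpow_sub_one s hp.le, ENNReal.mul_inv (Or.inl hs0) (Or.inl hst), mul_left_comm,
      mul_right_comm, ENNReal.inv_mul_cancel hs0 hst, one_mul]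

theorem boundedOnLp_iff {ν : Measure ℝ} {p : ℝ} (hp : 0 < p) {T : (ℝ → ℝ) → ℝ → ℝ≥0∞} :
    BoundedOnLp ν (ENNReal.ofReal p) T ↔ ∃ C : ℝ≥0, ∀ f : ℝ → ℝ, MemLp f (ENNReal.ofReal p) ν →
      ∫⁻ x, T f x ^ p ∂ν ≤ C * ∫⁻ x, ‖f x‖ₑ ^ p ∂ν := by
  have h0 : ENNReal.ofReal p ≠ 0 := by simpa using hp
  have key : ∀ (C : ℝ≥0) (f : ℝ → ℝ), eLpNorm (T f) (ENNReal.ofReal p) ν ≤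
      C * eLpNorm f (ENNReal.ofReal p) ν ↔
      ∫⁻ x, T f x ^ p ∂ν ≤ (C ^ p : ℝ≥0) * ∫⁻ x, ‖f x‖ₑ ^ p ∂ν := by
    intro C f
    rw [eLpNorm_eq_lintegral_rpow_enorm_toReal h0 ENNReal.ofReal_ne_top,
      eLpNorm_eq_lintegral_rpow_enorm_toReal h0 ENNReal.ofReal_ne_top, ENNReal.toReal_ofReal hp.le,
      one_div, ENNReal.rpow_inv_le_iff hp, ENNReal.mul_rpow_of_nonneg _ _ hp.le, ← ENNReal.rpow_mul,
      inv_mul_cancel₀ hp.ne', ENNReal.rpow_one, ENNReal.coe_rpow_of_nonneg _ hp.le]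
    simp only [enorm_eq_self]
  constructor
  · rintro ⟨C, hC⟩
    exact ⟨C ^ p, fun f hf => (key C f).1 (hC f hf)⟩
  · rintro ⟨C, hC⟩
    refine ⟨C ^ p⁻¹, fun f hf => (key _ f).2 ?_⟩
    rw [← NNReal.rpow_mul, inv_mul_cancel₀ hp.ne', NNReal.rpow_one]
    exact hC f hf

theorem boundedOnLp_of_memApb [IsLocallyFiniteMeasure μ] (hμ : IsBalanced μ) {w : ℝ → ℝ} (N : ℕ)
    {p : ℝ} (hp : 1 < p) (h : MemApb μ p w) :
    BoundedOnLp (weighted μ w) (ENNReal.ofReal p) (maximal μ N) := by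
  obtain ⟨hw, hchar⟩ := h
  have hp0 : 0 < p := by linarith
  have hp1 : 0 < p - 1 := by linarith
  have hq := Real.HolderConjugate.conjExponent hp
  obtain ⟨C, hC⟩ := hμ.exists_balancedWith
  lift apbChar μ p w to ℝ≥0 using hchar.ne with A hAdef
  have hA : apbChar μ p w ≤ A := hAdef.ge
  obtain ⟨c, K₁, h₁⟩ := exists_maximal_le (hw.adapted_of_apbChar_le hp hC hA) hp0.le hC N
  obtain ⟨K₂, h₂⟩ := exists_strongType_pairMaximal (N + 2) c hq.symm.lt
  obtain ⟨K₃, h₃⟩ := IsWeight.exists_lintegral_dualMaximal_le (μ := μ) hp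
  set q := p.conjExponent
  have hpq : (p - 1) * q = p := by
    simp only [q, Real.conjExponent]
    field_simp
  rw [boundedOnLp_iff hp0]
  refine ⟨K₁ ^ p * A ^ q * K₂ * K₃, fun f hf => ?_⟩
  have hF : AEMeasurable (fun x => ‖f x‖ₑ) μ :=
    hf.aestronglyMeasurable.enorm.mono_ac hw.absolutelyContinuous_weighted
  set ν := weighted μ w
  set h : ℝ → ℝ≥0∞ := fun x =>
    dualMaximal μ p w (fun x => ‖f x‖ₑ) x ^ (p - 1) / ENNReal.ofReal (w x)
  have hh : AEMeasurable h ν := (((measurable_pairMaximal _).pow_const _).aemeasurable.div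
    hw.aemeasurable_ofReal).mono_ac (weighted_absolutelyContinuous w)
  have hpt : ∀ x, maximal μ N f x ^ p ≤
      (K₁ ^ p * A ^ q : ℝ≥0) * pairMaximal ν (NearPair ν (N + 2) c) h x ^ q := by
    intro x
    have hpow := rpow_pairMaximal_le (P := NearPair ν (N + 2) c) hp1
      (hw.average_rpow_le hp hA hF) x
    calc maximal μ N f x ^ p
        ≤ (K₁ * pairMaximal μ (NearPair ν (N + 2) c) (fun y => ‖f y‖ₑ) x) ^ p := by
          gcongr
          exact h₁ f x
      _ = K₁ ^ p * (pairMaximal μ (NearPair ν (N + 2) c) (fun y => ‖f y‖ₑ) x ^ (p - 1)) ^ q := by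
          rw [ENNReal.mul_rpow_of_nonneg _ _ hp0.le, ← ENNReal.rpow_mul, hpq]
      _ ≤ K₁ ^ p * (A * pairMaximal ν (NearPair ν (N + 2) c) h x) ^ q := by
          gcongr
          exact hq.symm.nonneg
      _ = _ := by
          rw [ENNReal.mul_rpow_of_nonneg _ _ hq.symm.nonneg, ENNReal.coe_mul,
            ENNReal.coe_rpow_of_nonneg _ hp0.le, ENNReal.coe_rpow_of_nonneg _ hq.symm.nonneg,
            mul_assoc]
  calc ∫⁻ x, maximal μ N f x ^ p ∂ν
      ≤ (K₁ ^ p * A ^ q : ℝ≥0) * ∫⁻ x, pairMaximal ν (NearPair ν (N + 2) c) h x ^ q ∂ν := by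
        rw [← lintegral_const_mul' _ _ ENNReal.coe_ne_top]
        exact lintegral_mono hpt
    _ ≤ (K₁ ^ p * A ^ q : ℝ≥0) * (K₂ * (K₃ * ∫⁻ x, ‖f x‖ₑ ^ p ∂ν)) := by
        gcongr
        exact (h₂ ν _ (controlled_nearPair ν _ c) h hh).trans (by gcongr; exact h₃ w hw _ hF)
    _ = _ := by
        push_cast
        ring

/-! ### Sufficiency for `p = 1` -/

namespace IsWeight

variable {w : ℝ → ℝ} (hw : IsWeight μ w)
include hw

theorem setLIntegral_le_eLpNorm_mul {F : ℝ → ℝ≥0∞} (hF : AEMeasurable F μ) (I : DyadicInterval) :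
    ∫⁻ x in I.toSet, F x ∂μ ≤
      (∫⁻ x in I.toSet, F x ∂weighted μ w) *
        eLpNorm (fun x => (w x)⁻¹) ∞ (μ.restrict I.toSet) := by
  have hFw : AEMeasurable (fun x => F x * ENNReal.ofReal (w x)) μ := hF.mul hw.aemeasurable_ofReal
  rw [setLIntegral_weighted hw.aemeasurable hF, ← lintegral_mul_const'' _ hFw.restrict]
  refine lintegral_mono_ae ?_
  rw [eLpNorm_exponent_top]
  filter_upwards [enorm_ae_le_eLpNormEssSup (fun x => (w x)⁻¹) (μ.restrict I.toSet),
    ae_restrict_of_ae hw.pos] with x hx hpos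
  have h1 : ENNReal.ofReal (w x) * ‖(w x)⁻¹‖ₑ = 1 := by
    rw [Real.enorm_of_nonneg (inv_nonneg.2 hpos.le), ← ENNReal.ofReal_mul hpos.le,
      mul_inv_cancel₀ hpos.ne', ENNReal.ofReal_one]
  calc F x = F x * (ENNReal.ofReal (w x) * ‖(w x)⁻¹‖ₑ) := by rw [h1, mul_one]
    _ = F x * ENNReal.ofReal (w x) * ‖(w x)⁻¹‖ₑ := (mul_assoc _ _ _).symm
    _ ≤ _ := by gcongr

theorem measure_le_mul_eLpNorm (I : DyadicInterval) :
    μ I.toSet ≤ weighted μ w I.toSet * eLpNorm (fun x => (w x)⁻¹) ∞ (μ.restrict I.toSet) := by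
  simpa using hw.setLIntegral_le_eLpNorm_mul (F := fun _ => 1) aemeasurable_const I

end IsWeight

theorem a1bChar_term_le {w : ℝ → ℝ} {A : ℝ≥0} (hA : a1bChar μ w ≤ A) {I J : DyadicInterval}
    (h : Adjacent I J) :
    cb μ 1 I J * (weighted μ w I.toSet / μ I.toSet) *
      (eLpNorm (fun x => (w x)⁻¹) ∞ (μ.restrict J.toSet) / μ J.toSet ^ ((1 : ℝ) - 1)) ≤ A := by
  refine le_trans ?_ hA
  rw [sub_self, ENNReal.rpow_zero, div_one, weighted_apply]
  exact le_iSup_of_le I <| le_iSup_of_le J <| le_iSup_of_le h le_rfl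

theorem IsWeight.adapted_of_a1bChar_le [IsLocallyFiniteMeasure μ] {w : ℝ → ℝ} (hw : IsWeight μ w)
    {C : ℝ≥0} (hC : BalancedWith μ C) {A : ℝ≥0} (hA : a1bChar μ w ≤ A) :
    Adapted μ (weighted μ w) 1 (A * (C ^ 3) ^ ((1 : ℝ) / 2)) :=
  adapted_of_characteristic_le le_rfl hC (weighted_absolutelyContinuous w)
    (M := fun I => eLpNorm (fun x => (w x)⁻¹) ∞ (μ.restrict I.toSet))
    (fun I => (ENNReal.rpow_one _).trans_le (hw.measure_le_mul_eLpNorm I))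
    (fun a I => eLpNorm_mono_measure _
      (Measure.restrict_mono (toSet_subset_ancestor a I) le_rfl))
    fun _ _ h => a1bChar_term_le hA h

theorem IsWeight.average_le_of_a1bChar_le [IsLocallyFiniteMeasure μ] {w : ℝ → ℝ}
    (hw : IsWeight μ w) {A : ℝ≥0} (hA : a1bChar μ w ≤ A) {F : ℝ → ℝ≥0∞} (hF : AEMeasurable F μ)
    (I : DyadicInterval) : average μ F I ≤ A * average (weighted μ w) F I := by
  rcases eq_or_ne (μ I.toSet) 0 with h0 | h0
  · rw [average, setLIntegral_measure_zero _ _ h0, ENNReal.zero_div]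
    exact zero_le
  have ht := measure_toSet_ne_top (μ := μ) I
  have hV0 : weighted μ w I.toSet ≠ 0 := fun h => h0 (hw.absolutelyContinuous_weighted h)
  have hchar := mul_le_of_diagonal_le le_rfl (fun h => weighted_absolutelyContinuous w h)
    (a1bChar_term_le hA (adjacent_self I))
  rw [ENNReal.rpow_one] at hchar
  rw [average, average, ENNReal.div_le_iff h0 ht, ← mul_div_assoc, ENNReal.mul_div_right_comm.symm]
  rw [ENNReal.le_div_iff_mul_le (Or.inl hV0) (Or.inl (hw.weighted_ne_top I))]
  calc _ ≤ (∫⁻ x in I.toSet, F x ∂weighted μ w) *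
        eLpNorm (fun x => (w x)⁻¹) ∞ (μ.restrict I.toSet) * weighted μ w I.toSet := by
        gcongr
        exact hw.setLIntegral_le_eLpNorm_mul hF I
    _ = (∫⁻ x in I.toSet, F x ∂weighted μ w) * (weighted μ w I.toSet *
        eLpNorm (fun x => (w x)⁻¹) ∞ (μ.restrict I.toSet)) := by ring
    _ ≤ (∫⁻ x in I.toSet, F x ∂weighted μ w) * (A * μ I.toSet) := by gcongr
    _ = _ := by ring

theorem weakTypeOneOne_of_memA1b [IsLocallyFiniteMeasure μ] (hμ : IsBalanced μ) {w : ℝ → ℝ} (N : ℕ)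
    (h : MemA1b μ w) : WeakTypeOneOne (weighted μ w) (maximal μ N) := by
  obtain ⟨hw, hchar⟩ := h
  obtain ⟨C, hC⟩ := hμ.exists_balancedWith
  lift a1bChar μ w to ℝ≥0 using hchar.ne with A hAdef
  have hA : a1bChar μ w ≤ A := hAdef.ge
  obtain ⟨c, K₁, h₁⟩ := exists_maximal_le (hw.adapted_of_a1bChar_le hC hA) zero_le_one hC N
  obtain ⟨K₂, h₂⟩ := exists_weakType_pairMaximal (N + 2) c
  set B : ℝ≥0 := K₁ * A + 1
  have hB : (B : ℝ≥0∞) ≠ 0 := by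
    have : 0 < B := by positivity
    exact_mod_cast this.ne'
  refine ⟨B * K₂, fun f hf t => ?_⟩
  have hF : AEMeasurable (fun x => ‖f x‖ₑ) μ :=
    hf.aestronglyMeasurable.enorm.mono_ac hw.absolutelyContinuous_weighted
  set ν := weighted μ w
  have hpt : ∀ x, maximal μ N f x ≤
      B * pairMaximal ν (NearPair ν (N + 2) c) (fun y => ‖f y‖ₑ) x := by
    intro x
    have hone := rpow_pairMaximal_le (P := NearPair ν (N + 2) c) (r := 1) one_pos
      (fun I => (ENNReal.rpow_one _).trans_le (hw.average_le_of_a1bChar_le hA hF I)) x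
    rw [ENNReal.rpow_one] at hone
    calc _ ≤ _ := h₁ f x
      _ ≤ K₁ * (A * pairMaximal ν (NearPair ν (N + 2) c) (fun y => ‖f y‖ₑ) x) := by gcongr
      _ = (K₁ * A : ℝ≥0) * pairMaximal ν (NearPair ν (N + 2) c) (fun y => ‖f y‖ₑ) x := by
        push_cast
        ring
      _ ≤ _ := by
        gcongr
        exact le_self_add
  have hsub : {x | (t : ℝ≥0∞) < maximal μ N f x} ⊆
      {x | (t : ℝ≥0∞) / B < pairMaximal ν (NearPair ν (N + 2) c) (fun y => ‖f y‖ₑ) x} :=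
    fun x (hx : (t : ℝ≥0∞) < maximal μ N f x) =>
      ENNReal.div_lt_of_lt_mul' (hx.trans_le (hpt x))
  calc t * ν {x | (t : ℝ≥0∞) < maximal μ N f x}
      ≤ B * (t / B * ν {x | (t : ℝ≥0∞) / B <
          pairMaximal ν (NearPair ν (N + 2) c) (fun y => ‖f y‖ₑ) x}) := by
        rw [← mul_assoc, ENNReal.mul_div_cancel hB ENNReal.coe_ne_top]
        exact mul_le_mul_right (measure_mono hsub) _
    _ ≤ B * (K₂ * ∫⁻ x, ‖f x‖ₑ ∂ν) := by
        gcongr B * ?_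
        exact h₂ ν _ (controlled_nearPair ν _ c) _ _
    _ = _ := by
        rw [eLpNorm_one_eq_lintegral_enorm]
        push_cast
        ring

/-! ### Necessity -/

theorem cb_mul_average_le_maximal {N : ℕ} (hN : 1 ≤ N) {I J : DyadicInterval} (h : Adjacent J I)
    (f : ℝ → ℝ) {x : ℝ} (hx : x ∈ I.toSet) :
    cb μ 1 J I * average μ (fun y => ‖f y‖ₑ) J ≤ maximal μ N f x := by
  have hd : J.dist I ≤ (N + 2 : ℕ) := h.dist_le.trans (by exact_mod_cast (by lia : 3 ≤ N + 2))
  refine le_iSup_of_le J <| le_iSup_of_le I <| le_iSup_of_le hd ?_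
  rw [indicator_of_mem hx]

/-- The truncation of the dual weight at height `n`, restricted to `J`: the test function for the
necessity of the `A_p^b` condition. -/
def testFunction (p : ℝ) (w : ℝ → ℝ) (J : DyadicInterval) (n : ℕ) : ℝ → ℝ :=
  J.toSet.indicator fun x => min (dualWeight p w x) n

namespace IsWeight

variable {w : ℝ → ℝ} (hw : IsWeight μ w) {p : ℝ} (hp : 1 < p)
include hw

theorem enorm_testFunction (J : DyadicInterval) (n : ℕ) : ∀ᵐ x ∂μ, ‖testFunction p w J n x‖ₑ =
    J.toSet.indicator (fun x => min (ENNReal.ofReal (dualWeight p w x)) n) x := by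
  filter_upwards [hw.dualWeight_pos p] with x hx
  by_cases hxJ : x ∈ J.toSet
  · rw [testFunction, indicator_of_mem hxJ, indicator_of_mem hxJ,
      Real.enorm_of_nonneg (by positivity), ENNReal.ofReal_min, ENNReal.ofReal_natCast]
  · simp [testFunction, hxJ]

theorem lintegral_enorm_testFunction (J : DyadicInterval) (n : ℕ) :
    ∫⁻ x in J.toSet, ‖testFunction p w J n x‖ₑ ∂μ =
      ∫⁻ x in J.toSet, min (ENNReal.ofReal (dualWeight p w x)) n ∂μ := by
  refine lintegral_congr_ae ?_
  filter_upwards [ae_restrict_of_ae (hw.enorm_testFunction J n),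
    ae_restrict_mem J.measurableSet_toSet] with x hx hxJ
  rw [hx, indicator_of_mem hxJ]

theorem aestronglyMeasurable_testFunction (J : DyadicInterval) (n : ℕ) :
    AEStronglyMeasurable (testFunction p w J n) μ :=
  (((hw.aemeasurable_dualWeight p).min aemeasurable_const).indicator
    J.measurableSet_toSet).aestronglyMeasurable

include hp

theorem lintegral_testFunction_rpow_le (J : DyadicInterval) (n : ℕ) :
    ∫⁻ x, ‖testFunction p w J n x‖ₑ ^ p ∂weighted μ w ≤
      ∫⁻ x in J.toSet, min (ENNReal.ofReal (dualWeight p w x)) n ∂μ := by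
  have hp1 : 0 < p - 1 := by linarith
  rw [lintegral_weighted hw.aemeasurable
    ((hw.aestronglyMeasurable_testFunction J n).enorm.pow_const p),
    ← lintegral_indicator J.measurableSet_toSet]
  refine lintegral_mono_ae ?_
  filter_upwards [hw.enorm_testFunction (p := p) J n, hw.dualWeight_rpow_mul hp] with x hx hdual
  rw [hx]
  by_cases hxJ : x ∈ J.toSet
  · rw [indicator_of_mem hxJ, rpow_eq_mul_rpow_sub_one _ hp.le, mul_assoc]
    refine mul_le_of_le_one_right' ?_
    rw [← hdual]
    gcongr
    exact min_le_left _ _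
  · simp [hxJ, show 0 < p by linarith]

theorem memLp_testFunction [IsLocallyFiniteMeasure μ] (J : DyadicInterval) (n : ℕ) :
    MemLp (testFunction p w J n) (ENNReal.ofReal p) (weighted μ w) := by
  have hp0 : 0 < p := by linarith
  refine ⟨(hw.aestronglyMeasurable_testFunction J n).mono_ac (weighted_absolutelyContinuous w), ?_⟩
  rw [eLpNorm_eq_lintegral_rpow_enorm_toReal (by simpa using hp0) ENNReal.ofReal_ne_top,
    ENNReal.toReal_ofReal hp0.le]
  refine ENNReal.rpow_lt_top_of_nonneg (by positivity) (ne_top_of_le_ne_top ?_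
    (hw.lintegral_testFunction_rpow_le hp J n))
  refine ne_top_of_le_ne_top ?_ (lintegral_mono fun x => min_le_right _ _)
  rw [setLIntegral_const]
  exact ENNReal.mul_ne_top (ENNReal.natCast_ne_top n) (measure_toSet_ne_top J)

/-- The testing inequality for a pair of adjacent intervals. -/
theorem dual_testing [IsLocallyFiniteMeasure μ] {N : ℕ} (hN : 1 ≤ N) {C : ℝ≥0}
    (hC : ∀ f : ℝ → ℝ, MemLp f (ENNReal.ofReal p) (weighted μ w) →
      ∫⁻ x, maximal μ N f x ^ p ∂weighted μ w ≤ C * ∫⁻ x, ‖f x‖ₑ ^ p ∂weighted μ w)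
    {I J : DyadicInterval} (h : Adjacent J I) :
    cb μ 1 J I ^ p * (weighted μ w I.toSet * weighted μ (dualWeight p w) J.toSet ^ (p - 1)) /
      μ J.toSet ^ p ≤ C := by
  have hp0 : 0 < p := by linarith
  have hp1 : 0 < p - 1 := by linarith
  set V := weighted μ w I.toSet
  set X : ℕ → ℝ≥0∞ := fun n => ∫⁻ x in J.toSet, min (ENNReal.ofReal (dualWeight p w x)) n ∂μ
  have hXt : ∀ n, X n ≠ ∞ := fun n => by
    refine ne_top_of_le_ne_top ?_ (lintegral_mono fun x => min_le_right _ _)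
    rw [setLIntegral_const]
    exact ENNReal.mul_ne_top (ENNReal.natCast_ne_top n) (measure_toSet_ne_top J)
  have htest : ∀ n, (cb μ 1 J I * (X n / μ J.toSet)) ^ p * V ≤ C * X n := by
    intro n
    set f := testFunction p w J n
    calc (cb μ 1 J I * (X n / μ J.toSet)) ^ p * V
        = ∫⁻ x in I.toSet, (cb μ 1 J I * average μ (fun y => ‖f y‖ₑ) J) ^ p ∂weighted μ w := by
          rw [setLIntegral_const, average, hw.lintegral_enorm_testFunction]
      _ ≤ ∫⁻ x in I.toSet, maximal μ N f x ^ p ∂weighted μ w := by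
          refine setLIntegral_mono' I.measurableSet_toSet fun x hx => ?_
          gcongr
          exact cb_mul_average_le_maximal hN h f hx
      _ ≤ ∫⁻ x, maximal μ N f x ^ p ∂weighted μ w := setLIntegral_le_lintegral _ _
      _ ≤ C * ∫⁻ x, ‖f x‖ₑ ^ p ∂weighted μ w := hC f (hw.memLp_testFunction hp J n)
      _ ≤ C * X n := by
          gcongr
          exact hw.lintegral_testFunction_rpow_le hp J n
  have hn : ∀ n, cb μ 1 J I ^ p * (V * X n ^ (p - 1)) / μ J.toSet ^ p ≤ C := by
    intro n
    rcases eq_or_ne (X n) 0 with h0 | h0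
    · rw [h0, ENNReal.zero_rpow_of_pos hp1, mul_zero, mul_zero, ENNReal.zero_div]
      exact zero_le
    refine (ENNReal.mul_le_mul_iff_left h0 (hXt n)).1 (le_trans (le_of_eq ?_) (htest n))
    rw [ENNReal.mul_rpow_of_nonneg _ _ hp0.le, ENNReal.div_rpow_of_nonneg _ _ hp0.le,
      rpow_eq_mul_rpow_sub_one (X n) hp.le]
    simp only [div_eq_mul_inv]
    ring
  have hsup : weighted μ (dualWeight p w) J.toSet = ⨆ n, X n := by
    rw [weighted_apply, ← lintegral_iSup']
    · refine lintegral_congr fun x => ?_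
      refine le_antisymm ?_ (iSup_le fun n => min_le_left _ _)
      obtain ⟨n, hn⟩ := ENNReal.exists_nat_gt
        (ENNReal.ofReal_ne_top (r := dualWeight p w x))
      exact le_iSup_of_le n (le_min le_rfl hn.le)
    · exact fun n => ((hw.aemeasurable_dualWeight p).ennreal_ofReal.min aemeasurable_const).restrict
    · refine Filter.Eventually.of_forall fun x a b hab => ?_
      dsimp only
      gcongr
  have hpow : weighted μ (dualWeight p w) J.toSet ^ (p - 1) = ⨆ n, X n ^ (p - 1) := by
    rw [hsup]
    exact (ENNReal.orderIsoRpow (p - 1) hp1).map_iSup X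
  rw [hpow, ENNReal.mul_iSup, ENNReal.mul_iSup, ENNReal.iSup_div]
  exact iSup_le hn

theorem memApb_of_boundedOnLp [IsLocallyFiniteMeasure μ] {N : ℕ} (hN : 1 ≤ N)
    (h : BoundedOnLp (weighted μ w) (ENNReal.ofReal p) (maximal μ N)) : MemApb μ p w := by
  have hp1 : 0 < p - 1 := by linarith
  obtain ⟨C, hC⟩ := (boundedOnLp_iff (by linarith)).1 h
  refine ⟨hw, lt_of_le_of_lt ?_ (ENNReal.coe_lt_top (r := C))⟩
  refine iSup_le fun I => iSup_le fun J => iSup_le fun hIJ => ?_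
  rw [average_dualWeight_rpow hp, average, ← weighted_apply]
  rcases eq_or_ne (μ I.toSet) 0 with hI | hI
  · rw [weighted_absolutelyContinuous w hI, ENNReal.zero_div, mul_zero, zero_mul]
    exact zero_le
  rcases eq_or_ne (μ J.toSet) 0 with hJ | hJ
  · rw [weighted_absolutelyContinuous _ hJ, ENNReal.zero_rpow_of_pos hp1, ENNReal.zero_div,
      mul_zero]
    exact zero_le
  rw [cb_mul_eq hp.le hI hJ]
  exact hw.dual_testing hp hN hC hIJ.symm

omit hp

/-- Testing the weak type inequality on the part of `J` where `w⁻¹` exceeds `b`. -/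
theorem weak_testing [IsLocallyFiniteMeasure μ] {N : ℕ} (hN : 1 ≤ N) {C : ℝ≥0}
    (hC : ∀ f : ℝ → ℝ, MemLp f 1 (weighted μ w) → ∀ t : ℝ≥0,
      t * weighted μ w {x | (t : ℝ≥0∞) < maximal μ N f x} ≤ C * eLpNorm f 1 (weighted μ w))
    {I J : DyadicInterval} (h : Adjacent J I) {b : ℝ≥0∞}
    (hb : b < eLpNorm (fun x => (w x)⁻¹) ∞ (μ.restrict J.toSet)) :
    cb μ 1 J I * (weighted μ w I.toSet * b) / μ J.toSet ≤ C := by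
  set V := weighted μ w I.toSet
  have hmk := hw.aemeasurable.ae_eq_mk
  set w' := hw.aemeasurable.mk w
  have hw' : Measurable w' := hw.aemeasurable.measurable_mk
  set E : Set ℝ := J.toSet ∩ {x | b < ‖(w' x)⁻¹‖ₑ}
  have hE : MeasurableSet E :=
    J.measurableSet_toSet.inter (measurableSet_lt measurable_const hw'.inv.enorm)
  have hEJ : μ E ≤ μ J.toSet := measure_mono inter_subset_left
  have hEt : μ E ≠ ∞ := ne_top_of_le_ne_top (measure_toSet_ne_top J) hEJ
  have hE0 : μ E ≠ 0 := by
    intro h0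
    refine hb.not_ge ?_
    rw [eLpNorm_exponent_top]
    refine essSup_le_of_ae_le _ ?_
    rw [Filter.EventuallyLE, ae_restrict_iff' J.measurableSet_toSet]
    filter_upwards [hmk, measure_eq_zero_iff_ae_notMem.1 h0] with x hx hxE hxJ
    by_contra hlt
    refine hxE ⟨hxJ, ?_⟩
    rw [mem_ofPred_eq, ← hx]
    exact not_le.1 hlt
  have hWE : b * weighted μ w E ≤ μ E := by
    rw [weighted, withDensity_apply _ hE, ← lintegral_const_mul'' _ hw.aemeasurable_ofReal.restrict,
      ← setLIntegral_one E]
    refine lintegral_mono_ae ?_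
    filter_upwards [ae_restrict_of_ae hmk, ae_restrict_of_ae hw.pos, ae_restrict_mem hE]
      with x hx hpos hxE
    have h1 : ‖(w x)⁻¹‖ₑ * ENNReal.ofReal (w x) = 1 := by
      rw [Real.enorm_of_nonneg (inv_nonneg.2 hpos.le), ← ENNReal.ofReal_mul (inv_nonneg.2 hpos.le),
        inv_mul_cancel₀ hpos.ne', ENNReal.ofReal_one]
    rw [← h1, hx]
    gcongr
    exact hxE.2.le
  have hWEt : weighted μ w E ≠ ∞ :=
    ne_top_of_le_ne_top (hw.weighted_ne_top J) (measure_mono inter_subset_left)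
  set f : ℝ → ℝ := E.indicator fun _ => 1
  have hnorm : ∀ x, ‖f x‖ₑ = E.indicator (fun _ => (1 : ℝ≥0∞)) x := fun x => by
    by_cases hx : x ∈ E <;> simp [f, hx]
  have hf1 : eLpNorm f 1 (weighted μ w) = weighted μ w E := by
    rw [eLpNorm_one_eq_lintegral_enorm]
    simp only [hnorm]
    rw [lintegral_indicator_const hE, one_mul]
  have hf : MemLp f 1 (weighted μ w) :=
    ⟨(measurable_const.indicator hE).aestronglyMeasurable, hf1 ▸ hWEt.lt_top⟩
  have havg : average μ (fun y => ‖f y‖ₑ) J = μ E / μ J.toSet := by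
    simp only [average, hnorm]
    rw [lintegral_indicator_const hE, one_mul, Measure.restrict_apply hE,
      inter_eq_left.2 (inter_subset_left : E ⊆ J.toSet)]
  have key : cb μ 1 J I * (μ E / μ J.toSet) * V ≤ C * weighted μ w E := by
    have hlt : ∀ t : ℝ≥0, (t : ℝ≥0∞) < cb μ 1 J I * (μ E / μ J.toSet) →
        t * V ≤ C * weighted μ w E := by
      intro t ht
      rw [← hf1]
      refine le_trans ?_ (hC f hf t)
      refine mul_le_mul_right (measure_mono fun x hx => ?_) _
      exact ht.trans_le (havg ▸ cb_mul_average_le_maximal hN h f hx)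
    rcases eq_or_ne V 0 with h0 | h0
    · rw [h0, mul_zero]
      exact zero_le
    have hVt : V ≠ ∞ := hw.weighted_ne_top I
    rw [← ENNReal.le_div_iff_mul_le (Or.inl h0) (Or.inl hVt)]
    refine ENNReal.le_of_forall_nnreal_lt fun t ht => ?_
    rw [ENNReal.le_div_iff_mul_le (Or.inl h0) (Or.inl hVt)]
    exact hlt t ht
  refine (ENNReal.mul_le_mul_iff_left hE0 hEt).1 ?_
  calc cb μ 1 J I * (V * b) / μ J.toSet * μ E
      = b * (cb μ 1 J I * (μ E / μ J.toSet) * V) := by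
        simp only [div_eq_mul_inv]
        ring
    _ ≤ b * (C * weighted μ w E) := by gcongr
    _ = C * (b * weighted μ w E) := by ring
    _ ≤ C * μ E := by gcongr

theorem memA1b_of_weakTypeOneOne [IsLocallyFiniteMeasure μ] {N : ℕ} (hN : 1 ≤ N)
    (h : WeakTypeOneOne (weighted μ w) (maximal μ N)) : MemA1b μ w := by
  obtain ⟨C, hC⟩ := h
  refine ⟨hw, lt_of_le_of_lt ?_ (ENNReal.coe_lt_top (r := C))⟩
  refine iSup_le fun I => iSup_le fun J => iSup_le fun hIJ => ?_
  rw [average, ← weighted_apply]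
  rcases eq_or_ne (μ I.toSet) 0 with hI | hI
  · rw [weighted_absolutelyContinuous w hI, ENNReal.zero_div, mul_zero, zero_mul]
    exact zero_le
  rcases eq_or_ne (μ J.toSet) 0 with hJ | hJ
  · rw [Measure.restrict_eq_zero.2 hJ, eLpNorm_measure_zero, mul_zero]
    exact zero_le
  refine ENNReal.mul_le_of_forall_lt fun a ha b hb => ?_
  have hid := cb_mul_eq (p := 1) le_rfl hI hJ (weighted μ w I.toSet) b
  rw [sub_self, ENNReal.rpow_zero, div_one, ENNReal.rpow_one, ENNReal.rpow_one] at hid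
  calc a * b ≤ cb μ 1 I J * (weighted μ w I.toSet / μ I.toSet) * b := by gcongr
    _ ≤ C := hid.trans_le (hw.weak_testing hN hC hIJ.symm hb)

end IsWeight

end BalancedDyadic

end

theorem proposition3p4 (μ : MeasureTheory.Measure ℝ) [MeasureTheory.IsLocallyFiniteMeasure μ]
    (hμ : BalancedDyadic.IsBalanced μ) (w : ℝ → ℝ) (hw : BalancedDyadic.IsWeight μ w)
    (N : ℕ) (hN : 1 ≤ N) :
    (∀ p : ℝ, 1 < p →
      (BalancedDyadic.BoundedOnLp (BalancedDyadic.weighted μ w) (ENNReal.ofReal p)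
          (BalancedDyadic.maximal μ N) ↔
        BalancedDyadic.MemApb μ p w)) ∧
    (BalancedDyadic.WeakTypeOneOne (BalancedDyadic.weighted μ w) (BalancedDyadic.maximal μ N) ↔
      BalancedDyadic.MemA1b μ w) :=
  ⟨fun _ hp => ⟨hw.memApb_of_boundedOnLp hp hN, BalancedDyadic.boundedOnLp_of_memApb hμ N hp⟩,
    hw.memA1b_of_weakTypeOneOne hN, BalancedDyadic.weakTypeOneOne_of_memA1b hμ N⟩
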